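/- **Theorem (Liveness of AlterBFT).** *System.* There are $n$ replicas, of which at most $f$ are Byzantine, $n>2f$; the others are honest. Signatures of honest replicas cannot be forged. A block is a pair (payload, hash of the predecessor block or nil); the hash function $id$ is injective and no block is its own proper ancestor. A message broadcast by an honest replica at time $t$ is received by every honest replica at time at most $t+\Delta_S$ if it is small (votes, silence messages, certificates), and at most $\max\{t,GST\}+\Delta_L$ if it carries a block (proposals), where $0<\Delta_S\le\Delta_L$. All honest replicas start within $\Delta_S$ time of each other, local clocks run at the same speed, local computation takes no time, only finitely many events happen in bounded time, received messages are kept, and messages that are due at the time when a timer expires are handled before the timer. The payload an honest replica obtains, for a predecessor that is nil or a valid block, makes a valid block. *Protocol.* Epochs are $0,1,2,\dots$; epoch $e$ has a leader $\mathrm{leader}(e)$. Each replica keeps a most recent block certificate $lockedBC$ (initially nil); a block certificate of epoch $e$ consists of $f+1$ votes of epoch $e$ by distinct replicas for the same block hash, a silence certificate of $f+1$ silence messages of epoch $e$ by distinct replicas, an equivocation certificate of two votes of epoch $e$ signed by its leader for different hashes. - On starting epoch $e$, a replica marks it active and starts $timeoutCertificate(e)=\Delta_L+4\Delta_S$. The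 leader proposes at once if $e=0$ or its $lockedBC$ is from epoch $e-1$, and otherwise when $timeoutEpochChange(e)=2\Delta_S$ expires. To propose is to broadcast a new block that extends the block of $lockedBC$, together with $lockedBC$, and a signed vote for its hash. - A replica in the active epoch $e$ that has not voted in it, and has received a proposal $(b,BC)$ of epoch $e$ and the leader's vote for $id(b)$, votes for $b$ and forwards both messages, if $b$ is valid, the predecessor of $b$ is the block certified by $BC$ (none if $BC$ is nil), and its $lockedBC$ is nil or not more recent than $BC$. - A replica in epoch $e$ that holds a block certificate of epoch $e$ locks on it, starts $timeoutCommit(e)=2\Delta_S$ for its hash if epoch $e$ is active, broadcasts the certificate and starts epoch $e+1$. The leader of the current epoch that holds a block certificate of another epoch, more recent than its $lockedBC$, locks on it and broadcasts it. - A replica that holds a silence or equivocation certificate of an active epoch marks that epoch not-committed; if it is its current epoch, it broadcasts the certificate and starts epoch $e+1$ after $2\Delta_S$ if it is then still in epoch $e$. - If $timeoutCertificate(e)$ expires while the replica is in $e$ and $e$ is active, it broadcasts a silence message. - If $timeoutCommit(e)$ for a hash expires, or votes of epoch $e$ for a hash from all replicas have been received, while $e$ is active, the replica marks $e$ committed with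 that hash as decision; once it has received a proposal of epoch $e$ for a block with that hash, it commits this block and all its ancestors. *Claim.* In every execution: 1. In every epoch $e$ with an honest leader such that no honest replica starts $e$ before $GST$, the leader proposes a block, and every honest replica commits, with epoch $e$ as the deciding epoch, the block that the leader proposes in $e$. 2. If infinitely many epochs have an honest leader, then all honest replicas keep committing new blocks: for every honest replica $p$ and every time $T$, at some time at least $T$ the replica $p$ commits a block that it had not committed before. -/

import Mathlib

open Filter

namespace AlterBFT

/-! ### Blocks, certificates, messages -/

/-- A block: a payload and the hash of its predecessor (`none` for a first block). -/
structure Block (Payload Id : Type*) where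
  payload : Payload
  prev : Option Id

/-- A block certificate `C_e(B)`: signatures of the replicas in `signers` on the vote for the block
hash `id` in epoch `epoch`. -/
structure BlockCert (R Id : Type*) where
  epoch : ℕ
  id : Id
  signers : Finset R

/-- The three kinds of certificates. `silence e S` holds signatures of the members of `S` on the
silence message of epoch `e`; `equiv e h h'` holds two votes of epoch `e`, for `h` and `h'`, signed
by the leader of epoch `e`. -/
inductive Cert (R Id : Type*) where
  | block (c : BlockCert R Id)
  | silence (e : ℕ) (signers : Finset R)
  | equiv (e : ℕ) (h h' : Id)

/-- The messages of the protocol; `vote` and `silence` carry the name of their signer. -/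
inductive Msg (R Payload Id : Type*) where
  | propose (e : ℕ) (b : Block Payload Id) (bc : Option (BlockCert R Id))
  | vote (e : ℕ) (h : Id) (signer : R)
  | silence (e : ℕ) (signer : R)
  | quitEpoch (c : Cert R Id)

/-- Messages of type L are the ones that carry a block; all others are of type S. -/
def Msg.IsLarge {R Payload Id : Type*} : Msg R Payload Id → Prop
  | .propose _ _ _ => True
  | _ => False

/-- The epoch of a certificate. -/
def Cert.epoch {R Id : Type*} : Cert R Id → ℕ
  | .block c => c.epoch
  | .silence e _ => e
  | .equiv e _ _ => e

/-- State of an epoch at a replica. -/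
inductive EpochStatus where
  | active
  | committed
  | notCommitted

/-- Timers: `timeoutEpochChange(e)`, `timeoutCertificate(e)` and `timeoutCommit(e, h)`, where
`h = none` stands for the special value nil. -/
inductive Timer (Id : Type*) where
  | epochChange (e : ℕ)
  | certificate (e : ℕ)
  | commit (e : ℕ) (h : Option Id)

/-! ### Parameters of the protocol -/

/-- The parameters: the bound `f` on the number of faulty replicas, the leader of each epoch, the
hash function, the external validity predicate, the payload that a replica gets when it has to
propose in an epoch a block with a given predecessor, and the two delay bounds. -/
structure Protocol (R Payload Id : Type*) where
  f : ℕ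
  leader : ℕ → R
  id : Block Payload Id → Id
  valid : Block Payload Id → Prop
  getPayload : R → ℕ → Option Id → Payload
  ΔS : ℝ
  ΔL : ℝ

/-- The local state of a replica. `outbox` records the messages that it has broadcast, with the time
of the broadcast; `timers` holds the running timers, with the time at which they expire; messages
that have been received are kept for ever. -/
structure LocalState (R Payload Id : Type*) where
  started : Bool
  epoch : ℕ
  hasVoted : Bool
  lockedBC : Option (BlockCert R Id)
  status : ℕ → Option EpochStatus
  decision : ℕ → Option Id
  committed : Set (Block Payload Id)
  timers : Set (Timer Id × ℝ)
  received : Set (Msg R Payload Id)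
  outbox : Set (Msg R Payload Id × ℝ)

namespace LocalState

variable {R Payload Id : Type*}

/-- The initial state, before bootstrapping. -/
def init : LocalState R Payload Id where
  started := false
  epoch := 0
  hasVoted := false
  lockedBC := none
  status := fun _ => none
  decision := fun _ => none
  committed := ∅
  timers := ∅
  received := ∅
  outbox := ∅

/-- Broadcast `m` to all replicas, the sender included. -/
def broadcast (s : LocalState R Payload Id) (now : ℝ) (m : Msg R Payload Id) :
    LocalState R Payload Id :=
  { s with outbox := insert (m, now) s.outbox }

/-- Start the timer `τ` with duration `d`. -/
def startTimer (s : LocalState R Payload Id) (now : ℝ) (τ : Timer Id) (d : ℝ) :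
    LocalState R Payload Id :=
  { s with timers := insert (τ, now + d) s.timers }

/-- Receive `m`. -/
def receive (s : LocalState R Payload Id) (m : Msg R Payload Id) : LocalState R Payload Id :=
  { s with received := insert m s.received }

end LocalState

namespace Protocol

variable {R Payload Id : Type*} (P : Protocol R Payload Id)

def timeoutEpochChange : ℝ := 2 * P.ΔS

def timeoutCertificate : ℝ := P.ΔL + 4 * P.ΔS

def timeoutCommit : ℝ := 2 * P.ΔS

/-- `a` is the predecessor of `b`. -/
def Parent (a b : Block Payload Id) : Prop := b.prev = some (P.id a)

/-- `b` extends `a`: `a` is `b` or an ancestor of `b`. -/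
def Extends (b a : Block Payload Id) : Prop := Relation.ReflTransGen P.Parent a b

/-- Time by which a message sent at time `t` between honest replicas is received. -/
noncomputable def deadline (GST : ℝ) (m : Msg R Payload Id) (t : ℝ) : ℝ :=
  open Classical in if m.IsLarge then max t GST + P.ΔL else t + P.ΔS

/-! ### Procedures -/

/-- `getBlock()`: a block that extends the block of `lockedBC`. -/
def getBlock (p : R) (s : LocalState R Payload Id) : Block Payload Id :=
  { payload := P.getPayload p s.epoch (s.lockedBC.map BlockCert.id)
    prev := s.lockedBC.map BlockCert.id }

/-- `Propose()`. -/
def propose (p : R) (now : ℝ) (s : LocalState R Payload Id) : LocalState R Payload Id :=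
  { (s.broadcast now (.propose s.epoch (P.getBlock p s) s.lockedBC)).broadcast now
      (.vote s.epoch (P.id (P.getBlock p s)) p) with
    hasVoted := true }

/-- The assignments at the start of `StartEpoch(e)`, and the start of `timeoutCertificate(e)`. -/
def enterEpoch (now : ℝ) (e : ℕ) (s : LocalState R Payload Id) : LocalState R Payload Id :=
  { s.startTimer now (.certificate e) P.timeoutCertificate with
    started := true
    epoch := e
    hasVoted := false
    status := Function.update s.status e (some .active)
    decision := Function.update s.decision e none }

open Classical in
/-- `StartEpoch(e)`. -/
noncomputable def startEpoch (p : R) (now : ℝ) (e : ℕ) (s : LocalState R Payload Id) :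
    LocalState R Payload Id :=
  if P.leader e = p then
    if e = 0 ∨ ∃ c ∈ s.lockedBC, c.epoch + 1 = e then
      P.propose p now (P.enterEpoch now e s)
    else
      (P.enterEpoch now e s).startTimer now (.epochChange e) P.timeoutEpochChange
  else P.enterEpoch now e s

/-- Reaction to an acceptable proposal: vote, forward the leader's vote and the proposal. -/
def castVote (p : R) (now : ℝ) (b : Block Payload Id) (bc : Option (BlockCert R Id))
    (s : LocalState R Payload Id) : LocalState R Payload Id :=
  { ((s.broadcast now (.vote s.epoch (P.id b) p)).broadcast now
      (.vote s.epoch (P.id b) (P.leader s.epoch))).broadcast now (.propose s.epoch b bc) with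
    hasVoted := true }

open Classical in
/-- Reaction to a block certificate of the current epoch: lock, start `timeoutCommit` if the epoch
is still active, broadcast the certificate, and start the next epoch. -/
noncomputable def lockAndAdvance (p : R) (now : ℝ) (c : BlockCert R Id)
    (s : LocalState R Payload Id) : LocalState R Payload Id :=
  let s₁ : LocalState R Payload Id := { s with lockedBC := some c }
  let s₂ := if s.status s.epoch = some .active then
    s₁.startTimer now (.commit s.epoch (some c.id)) P.timeoutCommit else s₁
  P.startEpoch p now (s.epoch + 1) (s₂.broadcast now (.quitEpoch (.block c)))

open Classical in
/-- `MisbehaviorDetected(c)` for an epoch that is still active. -/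
noncomputable def misbehaviorDetected (now : ℝ) (c : Cert R Id) (s : LocalState R Payload Id) :
    LocalState R Payload Id :=
  let s₁ : LocalState R Payload Id :=
    { s with status := Function.update s.status c.epoch (some .notCommitted) }
  if c.epoch = s.epoch then
    (s₁.broadcast now (.quitEpoch c)).startTimer now (.commit c.epoch none) P.timeoutCommit
  else s₁

/-- Both commit rules: epoch `e` is committed with decision `h`. -/
def decideEpoch (e : ℕ) (h : Id) (s : LocalState R Payload Id) : LocalState R Payload Id :=
  { s with
    status := Function.update s.status e (some .committed)
    decision := Function.update s.decision e (some h) }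

/-- `CommitBlock(b)`: commit `b` and all its predecessors. -/
def commitBlock (b : Block Payload Id) (s : LocalState R Payload Id) : LocalState R Payload Id :=
  { s with committed := s.committed ∪ {a | P.Extends b a} }

/-! ### Certificates known to a replica -/

/-- A block certificate has signatures of at least `f + 1` distinct replicas. -/
def WellFormed (c : BlockCert R Id) : Prop := P.f + 1 ≤ c.signers.card

/-- The replica holds the block certificate `c`: it has received it in a quit-epoch message, or it
has received the votes that make it up. -/
def HasBlockCert (s : LocalState R Payload Id) (c : BlockCert R Id) : Prop :=
  P.WellFormed c ∧
    (.quitEpoch (.block c) ∈ s.received ∨ ∀ q ∈ c.signers, .vote c.epoch c.id q ∈ s.received)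

/-- The replica holds the silence or equivocation certificate `c`: it has received it in a
quit-epoch message, or it has received the messages that make it up. -/
def HasMisbehaviorCert (s : LocalState R Payload Id) : Cert R Id → Prop
  | .block _ => False
  | .silence e S => P.f + 1 ≤ S.card ∧
      (.quitEpoch (.silence e S) ∈ s.received ∨ ∀ q ∈ S, .silence e q ∈ s.received)
  | .equiv e h h' => h ≠ h' ∧
      (.quitEpoch (.equiv e h h') ∈ s.received ∨
        (.vote e h (P.leader e) ∈ s.received ∧ .vote e h' (P.leader e) ∈ s.received))

/-- The validity check for a proposal `(b, bc)`: `b` satisfies the external predicate, and its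
predecessor is the block certified by `bc` (or there is none, and `bc` is nil). -/
def ValidProposal (b : Block Payload Id) (bc : Option (BlockCert R Id)) : Prop :=
  P.valid b ∧ b.prev = bc.map BlockCert.id ∧ ∀ c ∈ bc, P.WellFormed c

/-! ### The rules triggered by messages -/

/-- `P.Reaction p now s s'`: some `when receive ...` rule of replica `p` is enabled in state `s`, and
executing it at time `now` leads to `s'`. -/
inductive Reaction (p : R) (now : ℝ) (s : LocalState R Payload Id) :
    LocalState R Payload Id → Prop
  | vote (b : Block Payload Id) (bc : Option (BlockCert R Id))
      (hstart : s.started = true)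
      (hprop : .propose s.epoch b bc ∈ s.received)
      (hvote : .vote s.epoch (P.id b) (P.leader s.epoch) ∈ s.received)
      (hact : s.status s.epoch = some .active)
      (hvalid : P.ValidProposal b bc)
      (hnew : s.hasVoted = false)
      (hcond : s.lockedBC = none ∨
        ∃ c₀ c, s.lockedBC = some c₀ ∧ bc = some c ∧ c₀.epoch ≤ c.epoch) :
      Reaction p now s (P.castVote p now b bc s)
  | blockCert (c : BlockCert R Id)
      (hstart : s.started = true)
      (hcert : P.HasBlockCert s c)
      (hepoch : c.epoch = s.epoch) :
      Reaction p now s (P.lockAndAdvance p now c s)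
  | blockCertLeader (c : BlockCert R Id)
      (hstart : s.started = true)
      (hcert : P.HasBlockCert s c)
      (hepoch : c.epoch ≠ s.epoch)
      (hleader : P.leader s.epoch = p)
      (hrecent : ∀ c₀ ∈ s.lockedBC, c₀.epoch < c.epoch) :
      Reaction p now s
        (LocalState.broadcast { s with lockedBC := some c } now (.quitEpoch (.block c)))
  | fastCommit (e : ℕ) (h : Id)
      (hstart : s.started = true)
      (hvotes : ∀ q : R, .vote e h q ∈ s.received)
      (hact : s.status e = some .active) :
      Reaction p now s (decideEpoch e h s)
  | commitBlock (e : ℕ) (b : Block Payload Id) (bc : Option (BlockCert R Id))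
      (hstart : s.started = true)
      (hprop : .propose e b bc ∈ s.received)
      (hdec : s.decision e = some (P.id b))
      (hnew : b ∉ s.committed) :
      Reaction p now s (P.commitBlock b s)
  | misbehavior (c : Cert R Id)
      (hstart : s.started = true)
      (hcert : P.HasMisbehaviorCert s c)
      (hact : s.status c.epoch = some .active) :
      Reaction p now s (P.misbehaviorDetected now c s)

/-- Some rule triggered by messages is enabled. -/
def Enabled (p : R) (now : ℝ) (s : LocalState R Payload Id) : Prop := ∃ s', P.Reaction p now s s'

/-! ### The rules triggered by timers -/

open Classical in
/-- The effect of the expiration of a timer. -/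
noncomputable def onTimeout (p : R) (now : ℝ) (s : LocalState R Payload Id) :
    Timer Id → LocalState R Payload Id
  | .epochChange e => if s.epoch = e then P.propose p now s else s
  | .certificate e =>
      if s.epoch = e ∧ s.status e = some .active then s.broadcast now (.silence e p) else s
  | .commit e (some h) => if s.status e = some .active then decideEpoch e h s else s
  | .commit e none => if s.epoch = e then P.startEpoch p now (e + 1) s else s

/-- Remove the expired timer and execute its rule. -/
noncomputable def timeoutStep (p : R) (now : ℝ) (τ : Timer Id) (s : LocalState R Payload Id) :
    LocalState R Payload Id :=
  P.onTimeout p now { s with timers := s.timers \ {(τ, now)} } τ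

end Protocol

/-! ### Executions in the hybrid synchronous model -/

/-- Events. `idle` does not concern any honest replica. -/
inductive Event (R Payload Id : Type*) where
  | idle
  | bootstrap (p : R)
  | receive (p : R) (m : Msg R Payload Id)
  | react (p : R)
  | timeout (p : R) (τ : Timer Id)

/-- The replica at which an event takes place. -/
def Event.actor {R Payload Id : Type*} : Event R Payload Id → Option R
  | .idle => none
  | .bootstrap p => some p
  | .receive p _ => some p
  | .react p => some p
  | .timeout p _ => some p

section Signatures

variable {R Payload Id : Type*} (P : Protocol R Payload Id) (honest : Set R)
  (state : R → LocalState R Payload Id)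

/-- The signature of `q` on the vote for `h` in epoch `e` is available: signatures of honest replicas
cannot be forged, those of faulty replicas are at the disposal of the adversary. -/
def VoteSigned (e : ℕ) (h : Id) (q : R) : Prop :=
  q ∈ honest → ∃ t, (.vote e h q, t) ∈ (state q).outbox

/-- The signature of `q` on the silence message of epoch `e` is available. -/
def SilenceSigned (e : ℕ) (q : R) : Prop :=
  q ∈ honest → ∃ t, (.silence e q, t) ∈ (state q).outbox

/-- All signatures in a certificate are available. -/
def CertSigned : Cert R Id → Prop
  | .block c => ∀ q ∈ c.signers, VoteSigned honest state c.epoch c.id q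
  | .silence e S => ∀ q ∈ S, SilenceSigned honest state e q
  | .equiv e h h' =>
      VoteSigned honest state e h (P.leader e) ∧ VoteSigned honest state e h' (P.leader e)

/-- All signatures in a message are available. Proposals themselves are not signed. -/
def Authentic : Msg R Payload Id → Prop
  | .propose _ _ bc => ∀ c ∈ bc, CertSigned P honest state (.block c)
  | .vote e h q => VoteSigned honest state e h q
  | .silence e q => SilenceSigned honest state e q
  | .quitEpoch c => CertSigned P honest state c

end Signatures

/-- An execution of the protocol, as a sequence of events: event `i` takes place at time `time i` and
leads from `state i` to `state (i + 1)`. The states of faulty replicas are irrelevant; faulty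
replicas act by having any messages with available signatures delivered at any times. -/
structure Execution {R Payload Id : Type*} (P : Protocol R Payload Id) (honest : Set R)
    (GST : ℝ) where
  time : ℕ → ℝ
  event : ℕ → Event R Payload Id
  state : ℕ → R → LocalState R Payload Id
  time_mono : Monotone time
  time_tendsto : Tendsto time atTop atTop
  state_zero : ∀ p ∈ honest, state 0 p = LocalState.init
  /-- A replica changes its state only in its own events. -/
  frame : ∀ i, ∀ p ∈ honest, (event i).actor ≠ some p → state (i + 1) p = state i p
  bootstrap_step : ∀ i, ∀ p ∈ honest, event i = .bootstrap p →
    (state i p).started = false ∧ state (i + 1) p = P.startEpoch p (time i) 0 (state i p)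
  receive_step : ∀ i, ∀ p ∈ honest, ∀ m, event i = .receive p m →
    Authentic P honest (state i) m ∧ state (i + 1) p = (state i p).receive m
  react_step : ∀ i, ∀ p ∈ honest, event i = .react p →
    P.Reaction p (time i) (state i p) (state (i + 1) p)
  timeout_step : ∀ i, ∀ p ∈ honest, ∀ τ, event i = .timeout p τ →
    (τ, time i) ∈ (state i p).timers ∧ state (i + 1) p = P.timeoutStep p (time i) τ (state i p)
  /-- Local computation takes no time: time does not advance while a rule is enabled. -/
  urgent : ∀ i, ∀ p ∈ honest, P.Enabled p (time i) (state (i + 1) p) → time (i + 1) = time i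
  /-- Time does not advance beyond the expiration of a timer. -/
  timer_due : ∀ i, ∀ p ∈ honest, ∀ τ x, (τ, x) ∈ (state i p).timers → time i ≤ x
  /-- Messages between honest replicas are received by their deadline. -/
  delivery : ∀ i, ∀ p ∈ honest, ∀ q ∈ honest, ∀ m t, (m, t) ∈ (state i p).outbox →
    P.deadline GST m t < time i → m ∈ (state i q).received
  /-- A timer that expires at time `x` is handled after the messages whose deadline is at most
  `x` have been received ... -/
  delivery_before_timeout : ∀ i, ∀ p ∈ honest, ∀ q ∈ honest, ∀ m t τ,
    (m, t) ∈ (state i p).outbox → event i = .timeout q τ → P.deadline GST m t ≤ time i →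
    m ∈ (state i q).received
  /-- ... and after the rules triggered by received messages have been executed. -/
  react_before_timeout : ∀ i, ∀ p ∈ honest, ∀ τ, event i = .timeout p τ →
    ¬ P.Enabled p (time i) (state i p)
  /-- All honest replicas start the execution within `Δ_S` time. -/
  start : ∃ t₀, ∀ p ∈ honest, ∃ i, event i = .bootstrap p ∧ t₀ ≤ time i ∧ time i ≤ t₀ + P.ΔS

namespace Execution

variable {R Payload Id : Type*} {P : Protocol R Payload Id} {honest : Set R} {GST : ℝ}
  (X : Execution P honest GST)

/-- Replica `p` is in epoch `e` just before event `i`. -/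
def InEpoch (p : R) (e i : ℕ) : Prop := (X.state i p).started = true ∧ (X.state i p).epoch = e

/-- Replica `p` starts epoch `e` in event `i`. -/
def StartsEpoch (p : R) (e i : ℕ) : Prop := ¬ X.InEpoch p e i ∧ X.InEpoch p e (i + 1)

/-- Epoch `e` is after GST: no honest replica starts it before GST. -/
def AfterGST (e : ℕ) : Prop := ∀ p ∈ honest, ∀ i, X.StartsEpoch p e i → GST ≤ X.time i

/-- Replica `p` broadcasts a proposal for block `b` in epoch `e`. -/
def Proposes (p : R) (e : ℕ) (b : Block Payload Id) : Prop :=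
  ∃ i bc t, (.propose e b bc, t) ∈ (X.state i p).outbox

/-- Replica `p` commits block `b` in epoch `e`: its decision for epoch `e` is the hash of `b`, and
`b` is among its committed blocks. -/
def CommitsIn (p : R) (e : ℕ) (b : Block Payload Id) : Prop :=
  ∃ i, (X.state i p).decision e = some (P.id b) ∧ b ∈ (X.state i p).committed

/-- In event `i` replica `p` commits the block `b`, which it had not committed before. -/
def CommitsNew (p : R) (b : Block Payload Id) (i : ℕ) : Prop :=
  b ∉ (X.state i p).committed ∧ b ∈ (X.state (i + 1) p).committed

end Execution

end AlterBFT

/-! Two facts hold in every epoch, before or after `GST`. Honest replicas enter it within `ΔS` of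
each other (`reached_sync`): whoever leaves the preceding epoch has broadcast the certificate for
leaving, a small message, and the pause after a misbehavior certificate is the same for everybody.
And no epoch lasts for ever (`exists_reached`): if all honest replicas were stuck in it, all would
sign silence, and these at least `f + 1` messages form a certificate that makes them leave.

Quorums give agreement. An honest replica signs votes for at most one hash per epoch
(`vote_unique`), a vote is cast only on top of the leader's vote (`leader_voted`), and `f + 1`
signatures include an honest one. So under an honest leader no equivocation certificate exists, and
every block certificate of the epoch is for the hash that the leader voted for.

The core is `noSilence`: after `GST` an honest leader is fast enough for `timeoutCertificate`. Its
length `ΔL + 4 ΔS` covers the skew in starting (`ΔS`), the leader's wait (`2 ΔS`), the transport of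
the proposal (`ΔL`) and that of the votes (`ΔS`). The leader's wait is what makes the proposal
acceptable to all: within it the locks of the others become frozen and reach the leader
(`proposal_recent`). Without silence there is no misbehavior certificate at all, so everybody leaves
the epoch with a block certificate, and either the fast path or `timeoutCommit` decides for the
leader's block (`exists_committed`, `commitsIn`).

For continued progress, leaving such an epoch `e` with a block certificate leaves a lock of epoch at
least `e` (`exists_lock`), so every block voted for later descends from the leader's block of `e`
(`later_vote_extends`). By acyclicity, the proposals of infinitely many such epochs are pairwise
different. Up to any time only finitely many hashes carry honest votes, and every committed block is
among them (`committed_voted`). Hence some proposal is not yet committed at that time, and it is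
committed later. -/

namespace AlterBFT

variable {R Payload Id : Type*}

namespace Protocol

variable (P : Protocol R Payload Id)

/-! ### Effect of `StartEpoch` on the fields of the state -/

/-- The block that `p` proposes in epoch `e` on top of the block certified by `bc`. -/
def newBlock (p : R) (e : ℕ) (bc : Option (BlockCert R Id)) : Block Payload Id :=
  { payload := P.getPayload p e (bc.map BlockCert.id)
    prev := bc.map BlockCert.id }

/-- The leader `p` of epoch `e` with lock `bc` proposes as soon as it starts `e`. -/
def Immediate (p : R) (e : ℕ) (bc : Option (BlockCert R Id)) : Prop :=
  P.leader e = p ∧ (e = 0 ∨ ∃ c ∈ bc, c.epoch + 1 = e)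

section startEpoch

variable (p : R) (now : ℝ) (e : ℕ) (s : LocalState R Payload Id)

@[simp] theorem startEpoch_started : (P.startEpoch p now e s).started = true := by
  unfold startEpoch; split_ifs <;> rfl

@[simp] theorem startEpoch_epoch : (P.startEpoch p now e s).epoch = e := by
  unfold startEpoch; split_ifs <;> rfl

@[simp] theorem startEpoch_lockedBC : (P.startEpoch p now e s).lockedBC = s.lockedBC := by
  unfold startEpoch; split_ifs <;> rfl

@[simp] theorem startEpoch_status :
    (P.startEpoch p now e s).status = Function.update s.status e (some .active) := by
  unfold startEpoch; split_ifs <;> rfl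

@[simp] theorem startEpoch_decision :
    (P.startEpoch p now e s).decision = Function.update s.decision e none := by
  unfold startEpoch; split_ifs <;> rfl

@[simp] theorem startEpoch_committed : (P.startEpoch p now e s).committed = s.committed := by
  unfold startEpoch; split_ifs <;> rfl

@[simp] theorem startEpoch_received : (P.startEpoch p now e s).received = s.received := by
  unfold startEpoch; split_ifs <;> rfl

@[simp] theorem startEpoch_hasVoted :
    (P.startEpoch p now e s).hasVoted = true ↔ P.Immediate p e s.lockedBC := by
  unfold startEpoch Immediate; split_ifs <;> simp_all [propose, enterEpoch, LocalState.startTimer]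

@[simp] theorem mem_startEpoch_timers (x : Timer Id × ℝ) :
    x ∈ (P.startEpoch p now e s).timers ↔ x = (.certificate e, now + P.timeoutCertificate) ∨
      (P.leader e = p ∧ ¬ P.Immediate p e s.lockedBC ∧
        x = (.epochChange e, now + P.timeoutEpochChange)) ∨ x ∈ s.timers := by
  unfold startEpoch Immediate
  split_ifs <;>
    simp_all [propose, enterEpoch, LocalState.startTimer, LocalState.broadcast]
  tauto

@[simp] theorem mem_startEpoch_outbox (m : Msg R Payload Id × ℝ) :
    m ∈ (P.startEpoch p now e s).outbox ↔ m ∈ s.outbox ∨ (P.Immediate p e s.lockedBC ∧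
      (m = (.propose e (P.newBlock p e s.lockedBC) s.lockedBC, now) ∨
        m = (.vote e (P.id (P.newBlock p e s.lockedBC)) p, now))) := by
  unfold startEpoch Immediate
  split_ifs <;>
    simp_all [propose, enterEpoch, LocalState.startTimer, LocalState.broadcast, getBlock,
      newBlock]
  tauto

end startEpoch

/-! ### Steps of a single replica -/

/-- The steps of an honest replica `p` at time `now`, when the messages in `auth` may be delivered and
the timers in `fires` expire. -/
inductive LocalStep (p : R) (now : ℝ) (auth : Msg R Payload Id → Prop) (fires : Timer Id → Prop)
    (s : LocalState R Payload Id) : LocalState R Payload Id → Prop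
  | idle : LocalStep p now auth fires s s
  | bootstrap (h : s.started = false) : LocalStep p now auth fires s (P.startEpoch p now 0 s)
  | receive (m : Msg R Payload Id) (h : auth m) : LocalStep p now auth fires s (s.receive m)
  | react (s' : LocalState R Payload Id) (h : P.Reaction p now s s') :
      LocalStep p now auth fires s s'
  | timeout (τ : Timer Id) (h : (τ, now) ∈ s.timers) (hτ : fires τ) :
      LocalStep p now auth fires s (P.timeoutStep p now τ s)

end Protocol

/-- Reduces the run, seen from one replica, to a relation between local states. Invariants and case
analyses over the rules can then be proved without mentioning the execution. -/
theorem Execution.localStep {P : Protocol R Payload Id} {honest : Set R} {GST : ℝ}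
    (X : Execution P honest GST) {p : R} (hp : p ∈ honest) (i : ℕ) :
    P.LocalStep p (X.time i) (Authentic P honest (X.state i)) (fun τ => X.event i = .timeout p τ)
      (X.state i p) (X.state (i + 1) p) := by
  by_cases ha : (X.event i).actor = some p
  · cases he : X.event i with
    | idle => simp [he, Event.actor] at ha
    | bootstrap q =>
      obtain rfl : q = p := by simpa [he, Event.actor] using ha
      obtain ⟨h₁, h₂⟩ := X.bootstrap_step i q hp he
      rw [h₂]; exact .bootstrap h₁
    | receive q m =>
      obtain rfl : q = p := by simpa [he, Event.actor] using ha
      obtain ⟨h₁, h₂⟩ := X.receive_step i q hp m he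
      rw [h₂]; exact .receive m h₁
    | react q =>
      obtain rfl : q = p := by simpa [he, Event.actor] using ha
      exact .react _ (X.react_step i q hp he)
    | timeout q τ =>
      obtain rfl : q = p := by simpa [he, Event.actor] using ha
      obtain ⟨h₁, h₂⟩ := X.timeout_step i q hp τ he
      rw [h₂]; exact .timeout τ h₁ rfl
  · rw [X.frame i p hp ha]; exact .idle

namespace Protocol

variable {P : Protocol R Payload Id} {p : R} {now : ℝ} {s s' : LocalState R Payload Id}

theorem HasBlockCert.mono {c : BlockCert R Id} (h : P.HasBlockCert s c)
    (hs : s.received ⊆ s'.received) : P.HasBlockCert s' c :=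
  ⟨h.1, h.2.imp (fun h => hs h) fun h q hq => hs (h q hq)⟩

theorem HasMisbehaviorCert.mono {c : Cert R Id} (h : P.HasMisbehaviorCert s c)
    (hs : s.received ⊆ s'.received) : P.HasMisbehaviorCert s' c := by
  cases c with
  | block c => exact h
  | silence e S => exact ⟨h.1, h.2.imp (fun h => hs h) fun h q hq => hs (h q hq)⟩
  | equiv e h₁ h₂ => exact ⟨h.1, h.2.imp (fun h => hs h) fun h => ⟨hs h.1, hs h.2⟩⟩


variable {auth : Msg R Payload Id → Prop} {fires : Timer Id → Prop}

/-- What a step of a replica never takes back. -/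
structure Grows (now : ℝ) (fires : Timer Id → Prop) (s s' : LocalState R Payload Id) : Prop where
  started : s.started = true → s'.started = true
  epoch_le : s.started = true → s.epoch ≤ s'.epoch
  epoch_le_succ : s'.epoch ≤ s.epoch + 1
  received : s.received ⊆ s'.received
  outbox : s.outbox ⊆ s'.outbox
  committed : s.committed ⊆ s'.committed
  timers : ∀ τ x, (τ, x) ∈ s.timers → (τ, x) ∈ s'.timers ∨ (x = now ∧ fires τ)

theorem LocalStep.grows (h : P.LocalStep p now auth fires s s') : Grows now fires s s' := by
  cases h with
  | idle => constructor <;> simp +contextual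
  | bootstrap h => constructor <;> simp +contextual [h, Set.subset_def]
  | receive m h => constructor <;> simp +contextual [LocalState.receive]
  | react _ h =>
    cases h with
    | vote => constructor <;> simp +contextual [castVote, LocalState.broadcast, Set.subset_def]
    | blockCert c _ _ _ =>
      unfold lockAndAdvance; dsimp only
      split_ifs <;> constructor <;>
        simp +contextual [LocalState.broadcast, LocalState.startTimer, Set.subset_def]
    | blockCertLeader => constructor <;> simp +contextual [LocalState.broadcast]
    | fastCommit => constructor <;> simp +contextual [decideEpoch]
    | commitBlock => constructor <;> simp +contextual [commitBlock]
    | misbehavior c _ _ _ =>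
      unfold misbehaviorDetected; dsimp only
      split_ifs <;> constructor <;>
        simp +contextual [LocalState.broadcast, LocalState.startTimer]
  | timeout τ h hτ =>
    rcases τ with e | e | ⟨e, _ | h⟩ <;> simp only [timeoutStep, onTimeout] <;> split_ifs <;>
      constructor <;>
      simp +contextual [propose, LocalState.broadcast, decideEpoch, Set.subset_def] <;> grind

/-- Invariants of the state of an honest replica `p`. -/
structure LocalInv (P : Protocol R Payload Id) (p : R) (s : LocalState R Payload Id) : Prop where
  unstarted : s.started = false → s.timers = ∅ ∧ s.outbox = ∅ ∧ s.lockedBC = none ∧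
    (∀ e, s.status e = none) ∧ (∀ e, s.decision e = none) ∧ s.hasVoted = false
  status_none : s.started = true → ∀ e, s.status e = none ↔ s.epoch < e
  notCommitted : ∀ e, s.status e = some .notCommitted →
    ∃ c, c.epoch = e ∧ P.HasMisbehaviorCert s c
  commitNil : s.started = true → s.status s.epoch = some .notCommitted →
    ∃ x, (.commit s.epoch none, x) ∈ s.timers
  decided : ∀ e h, s.decision e = some h → ∃ c, c.epoch = e ∧ c.id = h ∧ P.HasBlockCert s c
  commitTimer : ∀ e h x, (.commit e (some h), x) ∈ s.timers →
    ∃ c, c.epoch = e ∧ c.id = h ∧ P.HasBlockCert s c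
  committed : ∀ e, s.status e = some .committed → ∃ h, s.decision e = some h
  locked : ∀ c, s.lockedBC = some c →
    P.HasBlockCert s c ∧ ∃ t, (.quitEpoch (.block c), t) ∈ s.outbox
  voted : ∀ e h t, (.vote e h p, t) ∈ s.outbox →
    s.started = true ∧ e ≤ s.epoch ∧ (e = s.epoch → s.hasVoted = true)
  hasVoted : s.hasVoted = true → ∃ h t, (.vote s.epoch h p, t) ∈ s.outbox
  proposed : ∀ e b bc t, (.propose e b bc, t) ∈ s.outbox → (.vote e (P.id b) p, t) ∈ s.outbox
  epochChange : ∀ e x, (.epochChange e, x) ∈ s.timers →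
    s.started = true ∧ P.leader e = p ∧ e ≤ s.epoch

/-! ### Preservation of the local invariants -/

namespace LocalInv

theorem init : LocalInv P p LocalState.init := by
  constructor <;> simp [LocalState.init]

theorem startEpoch (e : ℕ) (I : LocalInv P p s) (T : Set (Timer Id × ℝ)) (hT : T ⊆ s.timers)
    (h : s.started = true ∧ e = s.epoch + 1 ∨ s.started = false ∧ e = 0) :
    LocalInv P p (P.startEpoch p now e { s with timers := T }) := by
  have hB : ∀ c, P.HasBlockCert (P.startEpoch p now e { s with timers := T }) c ↔
      P.HasBlockCert s c := by
    simp [HasBlockCert]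
  have hM : ∀ c, P.HasMisbehaviorCert (P.startEpoch p now e { s with timers := T }) c ↔
      P.HasMisbehaviorCert s c := by
    intro c; cases c <;> simp [HasMisbehaviorCert]
  obtain ⟨h1, h2, h3, h4, h5, h6, h7, h8, h9, h10, h11, h12⟩ := I
  constructor <;>
    simp only [startEpoch_started, startEpoch_epoch, startEpoch_lockedBC, startEpoch_status,
      startEpoch_decision, startEpoch_hasVoted, mem_startEpoch_timers,
      mem_startEpoch_outbox, Function.update_apply, hB, hM] <;>
    grind [Immediate]

theorem receive (m : Msg R Payload Id) (I : LocalInv P p s) : LocalInv P p (s.receive m) := by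
  have G : s.received ⊆ (s.receive m).received := Set.subset_insert _ _
  have hB : ∀ c, P.HasBlockCert s c → P.HasBlockCert (s.receive m) c := fun c h => h.mono G
  have hM : ∀ c, P.HasMisbehaviorCert s c → P.HasMisbehaviorCert (s.receive m) c :=
    fun c h => h.mono G
  obtain ⟨h1, h2, h3, h4, h5, h6, h7, h8, h9, h10, h11, h12⟩ := I
  constructor <;> simp only [LocalState.receive] at * <;> grind

theorem castVote (b : Block Payload Id) (bc : Option (BlockCert R Id)) (I : LocalInv P p s)
    (hs : s.started = true) : LocalInv P p (P.castVote p now b bc s) := by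
  have hB : ∀ c, P.HasBlockCert (P.castVote p now b bc s) c ↔ P.HasBlockCert s c := fun _ => .rfl
  have hM : ∀ c, P.HasMisbehaviorCert (P.castVote p now b bc s) c ↔ P.HasMisbehaviorCert s c :=
    fun c => by cases c <;> rfl
  obtain ⟨h1, h2, h3, h4, h5, h6, h7, h8, h9, h10, h11, h12⟩ := I
  constructor <;> (try simp only [hB, hM]) <;>
    simp only [Protocol.castVote, LocalState.broadcast, Set.mem_insert_iff] <;>
    clear hB hM <;> grind

theorem lock (c : BlockCert R Id) (I : LocalInv P p s) (hs : s.started = true)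
    (hc : P.HasBlockCert s c) :
    LocalInv P p
      (LocalState.broadcast { s with lockedBC := some c } now (.quitEpoch (.block c))) := by
  obtain ⟨h1, h2, h3, h4, h5, h6, h7, h8, h9, h10, h11, h12⟩ := I
  constructor
  case notCommitted => exact h3
  case decided => exact h5
  case commitTimer => exact h6
  case locked =>
    rintro c' hc'
    obtain rfl : c = c' := by simpa [LocalState.broadcast] using hc'
    exact ⟨hc, now, Set.mem_insert _ _⟩
  all_goals (simp only [LocalState.broadcast, Set.mem_insert_iff]; grind)

theorem startCommit (c : BlockCert R Id) (x : ℝ) (I : LocalInv P p s) (hs : s.started = true)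
    (hc : P.HasBlockCert s c) :
    LocalInv P p
      (s.startTimer now (.commit c.epoch (some c.id)) x) := by
  obtain ⟨h1, h2, h3, h4, h5, h6, h7, h8, h9, h10, h11, h12⟩ := I
  constructor
  case notCommitted => exact h3
  case decided => exact h5
  case locked => exact h8
  case commitTimer =>
    intro e h y hy
    simp only [LocalState.startTimer, Set.mem_insert_iff, Prod.mk.injEq, Timer.commit.injEq,
      Option.some.injEq] at hy
    rcases hy with ⟨⟨rfl, rfl⟩, -⟩ | hy
    · exact ⟨c, rfl, rfl, hc⟩
    · exact h6 e h y hy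
  all_goals (simp only [LocalState.startTimer, Set.mem_insert_iff]; grind)

theorem lockAndAdvance (c : BlockCert R Id) (I : LocalInv P p s) (hs : s.started = true)
    (hc : P.HasBlockCert s c) (he : c.epoch = s.epoch) :
    LocalInv P p (P.lockAndAdvance p now c s) := by
  unfold Protocol.lockAndAdvance; dsimp only
  split_ifs
  · rw [← he]
    exact startEpoch (c.epoch + 1) ((I.lock (now := now) c hs hc).startCommit (now := now) c
      P.timeoutCommit hs hc) _ subset_rfl (.inl ⟨hs, by rw [he]; rfl⟩)
  · exact startEpoch _ (I.lock (now := now) c hs hc) _ subset_rfl (.inl ⟨hs, rfl⟩)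

theorem decideEpoch (c : BlockCert R Id) (I : LocalInv P p s) (hc : P.HasBlockCert s c)
    (ha : s.status c.epoch = some .active) : LocalInv P p (decideEpoch c.epoch c.id s) := by
  obtain ⟨h1, h2, h3, h4, h5, h6, h7, h8, h9, h10, h11, h12⟩ := I
  constructor
  case commitTimer => exact h6
  case locked => exact h8
  case decided =>
    intro e h
    simp only [Protocol.decideEpoch, Function.update_apply]
    split_ifs with h'
    · simp only [Option.some.injEq]
      rintro rfl
      exact ⟨c, h'.symm, rfl, hc⟩
    · exact h5 e h
  case notCommitted =>
    intro e
    simp only [Protocol.decideEpoch, Function.update_apply]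
    split_ifs
    · simp
    · exact h3 e
  case committed =>
    intro e
    simp only [Protocol.decideEpoch, Function.update_apply]
    split_ifs
    · exact fun _ => ⟨_, rfl⟩
    · exact h7 e
  all_goals (simp only [Protocol.decideEpoch, Function.update_apply]; grind)

theorem commitBlock (b : Block Payload Id) (I : LocalInv P p s) :
    LocalInv P p (P.commitBlock b s) := by
  obtain ⟨h1, h2, h3, h4, h5, h6, h7, h8, h9, h10, h11, h12⟩ := I
  exact ⟨h1, h2, h3, h4, h5, h6, h7, h8, h9, h10, h11, h12⟩

theorem misbehaviorDetected (c : Cert R Id) (I : LocalInv P p s) (hs : s.started = true)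
    (hc : P.HasMisbehaviorCert s c) (ha : s.status c.epoch = some .active) :
    LocalInv P p (P.misbehaviorDetected now c s) := by
  have hB : ∀ c', P.HasBlockCert (P.misbehaviorDetected now c s) c' ↔ P.HasBlockCert s c' := by
    intro c'; unfold Protocol.misbehaviorDetected; dsimp only; split_ifs <;> rfl
  have hM : ∀ c', P.HasMisbehaviorCert (P.misbehaviorDetected now c s) c' ↔
      P.HasMisbehaviorCert s c' := by
    intro c'; unfold Protocol.misbehaviorDetected; dsimp only
    split_ifs <;> cases c' <;> rfl
  obtain ⟨h1, h2, h3, h4, h5, h6, h7, h8, h9, h10, h11, h12⟩ := I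
  constructor
  case commitNil =>
    unfold Protocol.misbehaviorDetected
    dsimp only
    split_ifs with he
    · exact fun _ _ => ⟨_, by rw [he]; exact Set.mem_insert _ _⟩
    · intro _ h
      exact h4 hs (by simpa [Function.update_apply, Ne.symm he] using h)
  all_goals
    try simp only [hB, hM]
    clear hB hM
    unfold Protocol.misbehaviorDetected
    dsimp only
    split_ifs <;>
    simp only [LocalState.broadcast, LocalState.startTimer, Set.mem_insert_iff,
      Function.update_apply] <;>
    grind

theorem removeTimer (I : LocalInv P p s) (T : Set (Timer Id × ℝ)) (hT : T ⊆ s.timers)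
    (hx : ∀ x, (.commit s.epoch none, x) ∈ s.timers → (.commit s.epoch none, x) ∈ T) :
    LocalInv P p { s with timers := T } := by
  obtain ⟨h1, h2, h3, h4, h5, h6, h7, h8, h9, h10, h11, h12⟩ := I
  exact ⟨fun h => ⟨Set.subset_empty_iff.1 (hT.trans (h1 h).1.le), (h1 h).2⟩, h2, h3,
    fun h h' => (h4 h h').imp hx, h5, fun e h x h' => h6 e h x (hT h'), h7, h8, h9, h10, h11,
    fun e x h => h12 e x (hT h)⟩

theorem propose (I : LocalInv P p s) (hs : s.started = true) :
    LocalInv P p (P.propose p now s) := by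
  have hB : ∀ c, P.HasBlockCert (P.propose p now s) c ↔ P.HasBlockCert s c := fun _ => .rfl
  have hM : ∀ c, P.HasMisbehaviorCert (P.propose p now s) c ↔ P.HasMisbehaviorCert s c :=
    fun c => by cases c <;> rfl
  obtain ⟨h1, h2, h3, h4, h5, h6, h7, h8, h9, h10, h11, h12⟩ := I
  constructor <;> (try simp only [hB, hM]) <;>
    simp only [Protocol.propose, LocalState.broadcast, Set.mem_insert_iff] <;>
    clear hB hM <;> grind

theorem broadcastSilence (I : LocalInv P p s) (hs : s.started = true) (e : ℕ) :
    LocalInv P p (s.broadcast now (.silence e p)) := by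
  obtain ⟨h1, h2, h3, h4, h5, h6, h7, h8, h9, h10, h11, h12⟩ := I
  constructor
  case notCommitted => exact h3
  case decided => exact h5
  case commitTimer => exact h6
  case locked => exact fun c hc =>
    ⟨(h8 c hc).1, (h8 c hc).2.imp fun t ht => Set.mem_insert_of_mem _ ht⟩
  all_goals (simp only [LocalState.broadcast, Set.mem_insert_iff]; grind)

theorem started_of_timer (I : LocalInv P p s) {x : Timer Id × ℝ} (h : x ∈ s.timers) :
    s.started = true := by
  by_contra hs
  rw [(I.unstarted (by simpa using hs)).1] at h
  exact h

theorem timeoutStep (I : LocalInv P p s) (τ : Timer Id) (h : (τ, now) ∈ s.timers) :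
    LocalInv P p (P.timeoutStep p now τ s) := by
  have hs := I.started_of_timer h
  have hT : s.timers \ {(τ, now)} ⊆ s.timers := Set.sdiff_subset
  rcases τ with e | e | ⟨e, _ | h'⟩ <;> simp only [Protocol.timeoutStep, onTimeout]
  · have J := I.removeTimer _ hT (by simp)
    split_ifs
    exacts [J.propose hs, J]
  · have J := I.removeTimer _ hT (by simp)
    split_ifs
    exacts [J.broadcastSilence hs e, J]
  -- Removing this timer alone would destroy the invariant `commitNil` of the current epoch. Removal
  -- and entry into the next epoch are therefore treated as one change, which is why `startEpoch`
  -- allows a smaller set of timers.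
  · split_ifs with he
    · subst he
      exact I.startEpoch _ _ hT (.inl ⟨hs, rfl⟩)
    · refine I.removeTimer _ hT fun x hx => ⟨hx, ?_⟩
      simp only [Set.mem_singleton_iff, Prod.mk.injEq, Timer.commit.injEq, and_true, not_and]
      exact fun h => absurd h he
  · have J := I.removeTimer _ hT (by simp)
    split_ifs with ha
    · obtain ⟨c, rfl, rfl, hc⟩ := I.commitTimer _ _ _ h
      exact J.decideEpoch c hc ha
    · exact J

theorem step [Fintype R] (hcard : P.f + 1 ≤ Fintype.card R) (I : LocalInv P p s)
    (h : P.LocalStep p now auth fires s s') : LocalInv P p s' := by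
  cases h with
  | idle => exact I
  | bootstrap h => exact I.startEpoch _ _ subset_rfl (.inr ⟨h, rfl⟩)
  | receive m h => exact I.receive m
  | timeout τ h hτ => exact I.timeoutStep τ h
  | react _ h =>
    cases h with
    | vote b bc hs => exact I.castVote b bc hs
    | blockCert c hs hc he => exact I.lockAndAdvance c hs hc he
    | blockCertLeader c hs hc => exact I.lock c hs hc
    | fastCommit e h hs hv ha =>
      -- The votes of all replicas are in particular a block certificate, so both commit rules
      -- decide only certified hashes.
      exact I.decideEpoch ⟨e, h, Finset.univ⟩
        ⟨by simpa [WellFormed] using hcard, .inr fun q _ => hv q⟩ ha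
    | commitBlock e b => exact I.commitBlock b
    | misbehavior c hs hc ha => exact I.misbehaviorDetected c hs hc ha

end LocalInv

/-! ### What a single step can change, and by which rule -/

@[simp] theorem lockAndAdvance_outbox (c : BlockCert R Id) (m : Msg R Payload Id × ℝ) :
    m ∈ (P.lockAndAdvance p now c s).outbox ↔ m = (.quitEpoch (.block c), now) ∨ m ∈ s.outbox ∨
      (P.Immediate p (s.epoch + 1) (some c) ∧
        (m = (.propose (s.epoch + 1) (P.newBlock p (s.epoch + 1) (some c)) (some c), now) ∨
          m = (.vote (s.epoch + 1) (P.id (P.newBlock p (s.epoch + 1) (some c))) p, now))) := by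
  unfold lockAndAdvance; dsimp only
  split_ifs <;> simp [LocalState.broadcast, LocalState.startTimer, or_assoc]

@[simp] theorem lockAndAdvance_timers (c : BlockCert R Id) (x : Timer Id × ℝ) :
    x ∈ (P.lockAndAdvance p now c s).timers ↔
      x = (.certificate (s.epoch + 1), now + P.timeoutCertificate) ∨
      (P.leader (s.epoch + 1) = p ∧ ¬ P.Immediate p (s.epoch + 1) (some c) ∧
        x = (.epochChange (s.epoch + 1), now + P.timeoutEpochChange)) ∨
      (s.status s.epoch = some .active ∧
        x = (.commit s.epoch (some c.id), now + P.timeoutCommit)) ∨ x ∈ s.timers := by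
  unfold lockAndAdvance; dsimp only
  split_ifs with h <;> simp [LocalState.broadcast, LocalState.startTimer, h]

theorem lockAndAdvance_fields (c : BlockCert R Id) :
    (P.lockAndAdvance p now c s).started = true ∧
    (P.lockAndAdvance p now c s).epoch = s.epoch + 1 ∧
    ((P.lockAndAdvance p now c s).hasVoted = true ↔ P.Immediate p (s.epoch + 1) (some c)) ∧
    (P.lockAndAdvance p now c s).lockedBC = some c ∧
    (P.lockAndAdvance p now c s).status = Function.update s.status (s.epoch + 1) (some .active) ∧
    (P.lockAndAdvance p now c s).decision = Function.update s.decision (s.epoch + 1) none ∧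
    (P.lockAndAdvance p now c s).committed = s.committed ∧
    (P.lockAndAdvance p now c s).received = s.received := by
  unfold lockAndAdvance; dsimp only
  split_ifs <;> simp [LocalState.broadcast, LocalState.startTimer]

open Classical in
theorem misbehaviorDetected_fields (c : Cert R Id) :
    (P.misbehaviorDetected now c s).started = s.started ∧
    (P.misbehaviorDetected now c s).epoch = s.epoch ∧
    (P.misbehaviorDetected now c s).hasVoted = s.hasVoted ∧
    (P.misbehaviorDetected now c s).lockedBC = s.lockedBC ∧
    (P.misbehaviorDetected now c s).status =
      Function.update s.status c.epoch (some .notCommitted) ∧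
    (P.misbehaviorDetected now c s).decision = s.decision ∧
    (P.misbehaviorDetected now c s).committed = s.committed ∧
    (P.misbehaviorDetected now c s).received = s.received ∧
    (P.misbehaviorDetected now c s).outbox =
      (if c.epoch = s.epoch then insert (.quitEpoch c, now) s.outbox else s.outbox) ∧
    (P.misbehaviorDetected now c s).timers =
      (if c.epoch = s.epoch then insert (.commit c.epoch none, now + P.timeoutCommit) s.timers
        else s.timers) := by
  unfold misbehaviorDetected; dsimp only
  split_ifs <;> simp [LocalState.broadcast, LocalState.startTimer]

theorem LocalStep.outbox_time (h : P.LocalStep p now auth fires s s') {x : Msg R Payload Id × ℝ}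
    (hx : x ∈ s'.outbox) : x ∈ s.outbox ∨ x.2 = now := by
  cases h with
  | idle => exact .inl hx
  | bootstrap h => simp at hx; grind
  | receive m h => exact .inl hx
  | react _ h =>
    cases h with
    | vote => simp [castVote, LocalState.broadcast] at hx; grind
    | blockCert c _ _ _ => simp at hx; grind
    | blockCertLeader => simp [LocalState.broadcast] at hx; grind
    | fastCommit => exact .inl hx
    | commitBlock => exact .inl hx
    | misbehavior c _ _ _ => grind [misbehaviorDetected_fields]
  | timeout τ h hτ =>
    rcases τ with e | e | ⟨e, _ | h⟩ <;> simp only [timeoutStep, onTimeout] at hx <;>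
      split_ifs at hx <;> simp [propose, LocalState.broadcast, decideEpoch] at hx <;> grind

theorem LocalStep.outbox_finite (h : P.LocalStep p now auth fires s s') (hs : s.outbox.Finite) :
    s'.outbox.Finite := by
  have hstart : ∀ e (s : LocalState R Payload Id), s.outbox.Finite →
      (P.startEpoch p now e s).outbox.Finite := by
    intro e s hs
    unfold startEpoch
    split_ifs <;>
      simp [propose, enterEpoch, LocalState.startTimer, LocalState.broadcast, hs]
  cases h with
  | idle => exact hs
  | bootstrap h => exact hstart _ _ hs
  | receive m h => exact hs
  | react _ h =>
    cases h with
    | vote => simpa [castVote, LocalState.broadcast] using hs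
    | blockCert c _ _ _ =>
      unfold lockAndAdvance; dsimp only
      exact hstart _ _ (by split_ifs <;> simpa [LocalState.broadcast, LocalState.startTimer])
    | blockCertLeader => simpa [LocalState.broadcast] using hs
    | fastCommit => exact hs
    | commitBlock => exact hs
    | misbehavior c _ _ _ =>
      rw [(misbehaviorDetected_fields c).2.2.2.2.2.2.2.2.1]; split_ifs <;> simp [hs]
  | timeout τ h hτ =>
    rcases τ with e | e | ⟨e, _ | h⟩ <;> simp only [timeoutStep, onTimeout] <;>
      split_ifs <;>
      first
      | exact hstart _ _ hs
      | simpa [propose, LocalState.broadcast, decideEpoch] using hs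

theorem LocalStep.received_auth (h : P.LocalStep p now auth fires s s') {m : Msg R Payload Id}
    (hm : m ∈ s'.received) : m ∈ s.received ∨ auth m := by
  cases h with
  | idle => exact .inl hm
  | bootstrap h => exact .inl (by simpa using hm)
  | receive m h => simp only [LocalState.receive, Set.mem_insert_iff] at hm; grind
  | react _ h =>
    left
    cases h with
    | blockCert c _ _ _ => grind [lockAndAdvance_fields]
    | misbehavior c _ _ _ => grind [misbehaviorDetected_fields]
    | _ => exact hm
  | timeout τ h hτ =>
    left
    rcases τ with e | e | ⟨e, _ | h⟩ <;> simp only [timeoutStep, onTimeout] at hm <;>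
      split_ifs at hm <;> simpa [propose, LocalState.broadcast, decideEpoch] using hm

/-- Only two rules assign the lock: one also moves to the next epoch, the other is reserved to the
leader. -/
theorem LocalStep.lockedBC_eq (h : P.LocalStep p now auth fires s s') 
    (he : s'.epoch = s.epoch) (hp : P.leader s.epoch ≠ p) : s'.lockedBC = s.lockedBC := by
  cases h with
  | idle => rfl
  | bootstrap h => simp
  | receive m h => rfl
  | react _ h =>
    cases h with
    | blockCert c _ _ _ => grind [lockAndAdvance_fields]
    | misbehavior c _ _ _ => grind [misbehaviorDetected_fields]
    | blockCertLeader => contradiction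
    | _ => rfl
  | timeout τ h hτ =>
    rcases τ with e | e | ⟨e, _ | h⟩ <;> simp only [timeoutStep, onTimeout] <;>
      split_ifs <;> simp [propose, LocalState.broadcast, decideEpoch]

/-- A lock is replaced only by a certificate of the current epoch or by a more recent one. -/
theorem LocalStep.lock (h : P.LocalStep p now auth fires s s') : s'.lockedBC = s.lockedBC ∨
    ∃ c, s'.lockedBC = some c ∧ (c.epoch = s.epoch ∨ ∀ c₀ ∈ s.lockedBC, c₀.epoch < c.epoch) := by
  cases h with
  | idle => exact .inl rfl
  | bootstrap h => simp
  | receive m h => exact .inl rfl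
  | react _ h =>
    cases h with
    | blockCert c _ _ he => exact .inr ⟨c, (lockAndAdvance_fields c).2.2.2.1, .inl he⟩
    | misbehavior c _ _ _ => grind [misbehaviorDetected_fields]
    | blockCertLeader c _ _ _ _ hr => exact .inr ⟨c, rfl, .inr hr⟩
    | _ => exact .inl rfl
  | timeout τ h hτ =>
    left
    rcases τ with e | e | ⟨e, _ | h⟩ <;> simp only [timeoutStep, onTimeout] <;>
      split_ifs <;> simp [propose, LocalState.broadcast, decideEpoch]

theorem LocalStep.silence (h : P.LocalStep p now auth fires s s') {e : ℕ} {q : R} {t : ℝ}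
    (hx : (.silence e q, t) ∈ s'.outbox) : (.silence e q, t) ∈ s.outbox ∨
      (q = p ∧ fires (.certificate e) ∧ (.certificate e, now) ∈ s.timers ∧ s.epoch = e) := by
  cases h with
  | idle => exact .inl hx
  | bootstrap h => simp at hx; grind
  | receive m h => exact .inl hx
  | react _ h =>
    cases h with
    | vote => simp [castVote, LocalState.broadcast] at hx; grind
    | blockCert c _ _ _ => simp at hx; grind
    | blockCertLeader => simp [LocalState.broadcast] at hx; grind
    | fastCommit => exact .inl hx
    | commitBlock => exact .inl hx
    | misbehavior c _ _ _ => grind [misbehaviorDetected_fields]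
  | timeout τ h hτ =>
    rcases τ with e | e | ⟨e, _ | h⟩ <;> simp only [timeoutStep, onTimeout] at hx <;>
      split_ifs at hx <;> simp [propose, LocalState.broadcast, decideEpoch] at hx <;> grind

theorem LocalStep.committed (h : P.LocalStep p now auth fires s s') {b : Block Payload Id}
    (hb : b ∈ s'.committed) : b ∈ s.committed ∨
      ∃ e b', s.decision e = some (P.id b') ∧ P.Extends b' b := by
  cases h with
  | idle => exact .inl hb
  | bootstrap h => exact .inl (by simpa using hb)
  | receive m h => exact .inl hb
  | react _ h =>
    cases h with
    | blockCert c _ _ _ => grind [lockAndAdvance_fields]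
    | misbehavior c _ _ _ => grind [misbehaviorDetected_fields]
    | commitBlock e b' bc _ _ hd _ => exact hb.imp (fun h => h) fun h => ⟨e, b', hd, h⟩
    | _ => exact .inl hb
  | timeout τ h hτ =>
    left
    rcases τ with e | e | ⟨e, _ | h⟩ <;> simp only [timeoutStep, onTimeout] at hb <;>
      split_ifs at hb <;> simpa [propose, LocalState.broadcast, decideEpoch] using hb

/-- Decisions are final: the rules that commit or discard an epoch require it to be active, and
starting an epoch resets only one beyond the current epoch. -/
theorem LocalStep.decision (h : P.LocalStep p now auth fires s s') {e : ℕ} {d : Id}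
    (hs : s.started = true) (he : e ≤ s.epoch) (hc : s.status e = some .committed)
    (hd : s.decision e = some d) : s'.status e = some .committed ∧ s'.decision e = some d := by
  cases h with
  | idle => exact ⟨hc, hd⟩
  | bootstrap h => simp [h] at hs
  | receive m h => exact ⟨hc, hd⟩
  | react _ h =>
    cases h with
    | blockCert c _ _ _ => simp only [lockAndAdvance_fields, Function.update_apply]; grind
    | misbehavior c _ _ _ => simp only [misbehaviorDetected_fields, Function.update_apply]; grind
    | fastCommit => simp only [decideEpoch, Function.update_apply]; grind
    | _ => exact ⟨hc, hd⟩
  | timeout τ h hτ =>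
    rcases τ with e | e | ⟨e, _ | h⟩ <;> simp only [timeoutStep, onTimeout] <;>
      split_ifs <;> simp [propose, LocalState.broadcast, decideEpoch, Function.update_apply] <;>
      grind

/-- Only the misbehavior rule starts this timer. The broadcast of the certificate at the same
instant is what allows the expiry to be compared with that at other replicas. -/
theorem LocalStep.commitNil (h : P.LocalStep p now auth fires s s') {e : ℕ} {x : ℝ}
    (hx : (.commit e none, x) ∈ s'.timers) : (.commit e none, x) ∈ s.timers ∨
      (x = now + P.timeoutCommit ∧ s.started = true ∧ s.epoch = e ∧
        ∃ c, c.epoch = e ∧ P.HasMisbehaviorCert s c ∧ (.quitEpoch c, now) ∈ s'.outbox) := by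
  cases h with
  | idle => exact .inl hx
  | bootstrap h => simp at hx; grind
  | receive m h => exact .inl hx
  | react _ h =>
    cases h with
    | blockCert c _ _ _ => simp at hx; grind
    | misbehavior c hs hc ha =>
      simp only [misbehaviorDetected_fields] at hx ⊢
      split_ifs at hx ⊢ with h
      · rcases hx with hx | hx
        · simp only [Prod.mk.injEq, Timer.commit.injEq, and_true] at hx
          exact .inr ⟨hx.2, hs, h.symm.trans hx.1.symm, c, hx.1.symm, hc, Set.mem_insert _ _⟩
        · exact .inl hx
      · exact .inl hx
    | _ => exact .inl hx
  | timeout τ h hτ =>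
    rcases τ with e | e | ⟨e, _ | h⟩ <;> simp only [timeoutStep, onTimeout] at hx <;>
      split_ifs at hx <;> simp [propose, LocalState.broadcast, decideEpoch] at hx <;> grind

/-- Both timers are started only on entry into their epoch, which happens once. Their expiry time
therefore determines the entry time, and conversely. -/
theorem LocalStep.epochTimer (h : P.LocalStep p now auth fires s s') {e : ℕ} {τ : Timer Id}
    {x d : ℝ} (hx : (τ, x) ∈ s'.timers)
    (hτ : τ = .certificate e ∧ d = P.timeoutCertificate ∨
      τ = .epochChange e ∧ d = P.timeoutEpochChange) :
    (τ, x) ∈ s.timers ∨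
      (x = now + d ∧ ¬ (s.started = true ∧ e ≤ s.epoch) ∧ s'.started = true ∧ e ≤ s'.epoch) := by
  cases h with
  | idle => exact .inl hx
  | bootstrap h => simp at hx; grind [startEpoch_started, startEpoch_epoch]
  | receive m h => exact .inl hx
  | react _ h =>
    cases h with
    | blockCert c _ _ _ => simp at hx; grind [lockAndAdvance_fields]
    | misbehavior c hs hc ha =>
      simp only [misbehaviorDetected_fields] at hx ⊢
      grind
    | _ => exact .inl hx
  | timeout τ h hτ =>
    rcases τ with e | e | ⟨e, _ | h⟩ <;> simp only [timeoutStep, onTimeout] at hx ⊢ <;>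
      split_ifs at hx ⊢ <;> simp [propose, LocalState.broadcast, decideEpoch] at hx ⊢ <;> grind

/-- How a replica comes to be in epoch `e`. -/
theorem LocalStep.start (h : P.LocalStep p now auth fires s s') (I : LocalInv P p s) {e : ℕ}
    (h₀ : ¬ (s.started = true ∧ e ≤ s.epoch)) (h₁ : s'.started = true) (h₂ : e ≤ s'.epoch) :
    s'.epoch = e ∧ s'.status e = some .active ∧
    (.certificate e, now + P.timeoutCertificate) ∈ s'.timers ∧
    (P.leader e = p → (∃ b bc, (.propose e b bc, now) ∈ s'.outbox) ∨
      (.epochChange e, now + P.timeoutEpochChange) ∈ s'.timers) ∧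
    (e = 0 ∧ s.started = false ∨ ∃ e', e = e' + 1 ∧ s.started = true ∧ s.epoch = e' ∧
      ((∃ c, c.epoch = e' ∧ P.HasBlockCert s c ∧ (.quitEpoch (.block c), now) ∈ s'.outbox ∧
          s'.lockedBC = some c ∧
          (s.status e' = some .active →
            (.commit e' (some c.id), now + P.timeoutCommit) ∈ s'.timers)) ∨
        (.commit e' none, now) ∈ s.timers)) := by
  cases h with
  | idle => grind
  | bootstrap h =>
    simp only [startEpoch_epoch, nonpos_iff_eq_zero] at h₂
    subst h₂
    simp only [startEpoch_epoch, startEpoch_status, Function.update_self, mem_startEpoch_timers,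
      mem_startEpoch_outbox]
    grind
  | receive m h => simp only [LocalState.receive] at *; grind
  | react _ h =>
    cases h with
    | vote => simp only [castVote, LocalState.broadcast] at *; grind
    | blockCert c hs hc he =>
      simp only [lockAndAdvance_fields] at h₂
      obtain rfl : e = s.epoch + 1 := by grind
      simp only [lockAndAdvance_fields, lockAndAdvance_outbox, lockAndAdvance_timers,
        Function.update_self]
      refine ⟨trivial, trivial, by simp, by grind, .inr ⟨s.epoch, rfl, hs, rfl, .inl ⟨c, ?_⟩⟩⟩
      simp [he, hc]
      tauto
    | blockCertLeader => simp only [LocalState.broadcast] at *; grind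
    | fastCommit => simp only [decideEpoch] at *; grind
    | commitBlock => simp only [commitBlock] at *; grind
    | misbehavior c _ _ _ => simp only [misbehaviorDetected_fields] at *; grind
  | timeout τ h hτ =>
    rcases τ with e' | e' | ⟨e', _ | h⟩ <;> simp only [timeoutStep, onTimeout] at *
    case commit.none =>
      split_ifs at *
      · have hs := I.started_of_timer h
        simp only [startEpoch_epoch] at h₂
        obtain rfl : e = e' + 1 := by grind
        simp only [startEpoch_epoch, startEpoch_status, Function.update_self,
          mem_startEpoch_timers, mem_startEpoch_outbox]
        grind
      · grind
    all_goals split_ifs at * <;>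
      simp only [propose, LocalState.broadcast, decideEpoch] at * <;> grind

theorem startEpoch_vote {e e' : ℕ} {d : Id} {t : ℝ} (h₀ : (.vote e d p, t) ∉ s.outbox)
    (h₁ : (.vote e d p, t) ∈ (P.startEpoch p now e' s).outbox) :
    t = now ∧ e' = e ∧ P.leader e = p ∧ (e = 0 ∨ ∃ c ∈ s.lockedBC, c.epoch + 1 = e) ∧
      d = P.id (P.newBlock p e s.lockedBC) ∧
      (.propose e (P.newBlock p e s.lockedBC) s.lockedBC, t) ∈
        (P.startEpoch p now e' s).outbox := by
  simp only [mem_startEpoch_outbox] at h₁ ⊢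
  grind [Immediate]

/-- A proposer builds on its own lock, so its vote passes the lock test that the voting rule imposes
on others. -/
theorem self_acceptable (bc : Option (BlockCert R Id)) :
    bc = none ∨ ∃ c₀ c, bc = some c₀ ∧ bc = some c ∧ c₀.epoch ≤ c.epoch := by
  cases bc with
  | none => exact .inl rfl
  | some c => exact .inr ⟨c, c, rfl, rfl, le_rfl⟩

/-- How a replica `p` comes to sign a vote. -/
theorem LocalStep.vote (h : P.LocalStep p now auth fires s s') (I : LocalInv P p s) {e : ℕ} {d : Id}
    {t : ℝ} (h₀ : (.vote e d p, t) ∉ s.outbox) (h₁ : (.vote e d p, t) ∈ s'.outbox) :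
    t = now ∧ s'.started = true ∧ s'.epoch = e ∧ ∃ b bc, d = P.id b ∧
      b.prev = bc.map BlockCert.id ∧ (.propose e b bc, t) ∈ s'.outbox ∧
      (s'.lockedBC = none ∨
        ∃ c₀ c, s'.lockedBC = some c₀ ∧ bc = some c ∧ c₀.epoch ≤ c.epoch) ∧
      ((s.started = true ∧ s.epoch = e ∧ s.hasVoted = false ∧ P.ValidProposal b bc ∧
          .propose e b bc ∈ s.received ∧ .vote e d (P.leader e) ∈ s.received) ∨
        (P.leader e = p ∧ b = P.newBlock p e bc ∧ (∀ c ∈ bc, P.HasBlockCert s c) ∧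
          ((¬ (s.started = true ∧ e ≤ s.epoch) ∧ (e = 0 ∨ ∃ c ∈ bc, c.epoch + 1 = e) ∧
              ∀ x, (.epochChange e, x) ∈ s'.timers → (.epochChange e, x) ∈ s.timers) ∨
            (fires (.epochChange e) ∧ (.epochChange e, now) ∈ s.timers ∧ s.epoch = e ∧
              bc = s.lockedBC ∧ s'.timers = s.timers \ {(.epochChange e, now)})))) := by
  cases h with
  | idle => grind
  | bootstrap h =>
    obtain ⟨rfl, rfl, hl, hi, rfl, hb⟩ := startEpoch_vote h₀ h₁
    exact ⟨rfl, startEpoch_started .., startEpoch_epoch .., _, _, rfl, rfl, hb,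
      startEpoch_lockedBC P p t 0 s ▸ self_acceptable _,
      .inr ⟨hl, rfl, fun c hc => (I.locked c hc).1, .inl ⟨by simp [h], hi,
        fun x hx => by simpa [Immediate, hl] using hx⟩⟩⟩
  | receive m h => exact absurd h₁ h₀
  | react _ h =>
    cases h with
    | vote b bc hs hp hv ha hval hn hc =>
      simp only [castVote, LocalState.broadcast, Set.mem_insert_iff, Prod.mk.injEq,
        Msg.vote.injEq, reduceCtorEq, false_and, false_or] at h₁ ⊢
      have h₂ : (e = s.epoch ∧ d = P.id b) ∧ t = now := by grind
      obtain ⟨⟨rfl, rfl⟩, rfl⟩ := h₂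
      exact ⟨rfl, hs, rfl, b, bc, rfl, hval.2.1, .inl ⟨rfl, rfl⟩, hc, .inl ⟨hs, rfl, hn, hval, hp, hv⟩⟩
    | blockCert c hs hc he =>
      have hf := lockAndAdvance_fields (P := P) (p := p) (now := now) (s := s) c
      have hv : P.Immediate p (s.epoch + 1) (some c) ∧ s.epoch + 1 = e ∧
          d = P.id (P.newBlock p (s.epoch + 1) (some c)) ∧ t = now := by
        simp only [lockAndAdvance_outbox] at h₁
        grind
      obtain ⟨hi, rfl, rfl, rfl⟩ := hv
      refine ⟨rfl, hf.1, hf.2.1, P.newBlock p (s.epoch + 1) (some c), some c, rfl, rfl, ?_, ?_,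
        .inr ⟨hi.1, rfl, ?_, .inl ⟨by simp, hi.2,
          fun x hx => by simpa [hi] using hx⟩⟩⟩
      · simp [hi]
      · rw [hf.2.2.2.1]; exact self_acceptable _
      · rintro _ ⟨⟩; exact hc
    | blockCertLeader => simp [LocalState.broadcast] at h₁; grind
    | fastCommit => exact absurd h₁ h₀
    | commitBlock => exact absurd h₁ h₀
    | misbehavior c _ _ _ => grind [misbehaviorDetected_fields]
  | timeout τ h hτ =>
    have hs := I.started_of_timer h
    rcases τ with e' | e' | ⟨e', _ | h⟩ <;> simp only [timeoutStep, onTimeout] at h₁ ⊢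
    · split_ifs at h₁ ⊢ with he
      · subst he
        have hv : s.epoch = e ∧ d = P.id (P.newBlock p s.epoch s.lockedBC) ∧ t = now := by
          simp only [propose, LocalState.broadcast, Set.mem_insert_iff, getBlock, newBlock] at *
          grind
        obtain ⟨rfl, rfl, rfl⟩ := hv
        refine ⟨rfl, hs, rfl, P.newBlock p s.epoch s.lockedBC, s.lockedBC, rfl, rfl,
          .inr (.inl rfl), self_acceptable _,
          .inr ⟨(I.epochChange _ _ h).2.1, rfl, fun c hc => (I.locked c hc).1,
            .inr ⟨hτ, h, rfl, rfl, rfl⟩⟩⟩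
      · exact absurd h₁ h₀
    · split_ifs at h₁ ⊢ with he
      · exact absurd (h₁.resolve_left (by simp)) h₀
      · exact absurd h₁ h₀
    · split_ifs at h₁ ⊢ with he
      · subst he
        obtain ⟨rfl, rfl, hl, hi, rfl, hb⟩ := startEpoch_vote
          (s := { s with timers := s.timers \ {(.commit s.epoch none, now)} }) h₀ h₁
        refine ⟨rfl, startEpoch_started .., startEpoch_epoch .., P.newBlock p _ s.lockedBC,
          s.lockedBC, rfl, rfl, hb, ?_, .inr ⟨hl, rfl, fun c hc => (I.locked c hc).1,
            .inl ⟨fun h => absurd h.2 (Nat.not_succ_le_self _), hi, fun x hx => ?_⟩⟩⟩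
        swap
        -- A leader that proposes at once does not start `epochChange`, so a running one must be
        -- old.
        · rw [mem_startEpoch_timers] at hx
          have hx := hx.resolve_left (by simp)
          exact Set.sdiff_subset
            (hx.resolve_left fun h => absurd (⟨hl, hi⟩ : P.Immediate p _ s.lockedBC) h.2.1)
        rw [startEpoch_lockedBC]
        exact self_acceptable _
      · exact absurd h₁ h₀
    · split_ifs at h₁ ⊢ with he <;> exact absurd h₁ h₀

/-- In a single step a replica signs at most one vote. -/
theorem LocalStep.vote_unique (h : P.LocalStep p now auth fires s s') {e : ℕ} {d d' : Id}
    {t t' : ℝ} (h₀ : (.vote e d p, t) ∉ s.outbox) (h₁ : (.vote e d p, t) ∈ s'.outbox)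
    (h₀' : (.vote e d' p, t') ∉ s.outbox) (h₁' : (.vote e d' p, t') ∈ s'.outbox) : d = d' := by
  cases h with
  | idle => grind
  | bootstrap h => simp at h₁ h₁'; grind
  | receive m h => exact absurd h₁ h₀
  | react _ h =>
    cases h with
    | vote => simp [castVote, LocalState.broadcast] at h₁ h₁'; grind
    | blockCert c _ _ _ => simp at h₁ h₁'; grind
    | blockCertLeader => simp [LocalState.broadcast] at h₁; grind
    | fastCommit => exact absurd h₁ h₀
    | commitBlock => exact absurd h₁ h₀
    | misbehavior c _ _ _ => grind [misbehaviorDetected_fields]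
  | timeout τ h hτ =>
    rcases τ with e | e | ⟨e, _ | h⟩ <;> simp only [timeoutStep, onTimeout] at h₁ h₁' <;>
      split_ifs at h₁ h₁' <;>
      simp [propose, LocalState.broadcast, decideEpoch] at h₁ h₁' <;> grind

end Protocol

/-- The standing assumptions on the system. -/
structure Assumptions [Fintype R] (P : Protocol R Payload Id) (honest : Set R) : Prop where
  two_mul_lt : 2 * P.f < Fintype.card R
  faulty : honestᶜ.ncard ≤ P.f
  ΔS_pos : 0 < P.ΔS
  ΔS_le : P.ΔS ≤ P.ΔL
  id_injective : Function.Injective P.id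
  payload : ∀ p ∈ honest, ∀ e prev, (∀ h ∈ prev, ∃ a, P.valid a ∧ P.id a = h) →
    P.valid ⟨P.getPayload p e prev, prev⟩

/-! ### Counting in quorums -/

namespace Assumptions

variable [Fintype R] {P : Protocol R Payload Id} {honest : Set R}

theorem card_le (A : Assumptions P honest) : P.f + 1 ≤ Fintype.card R := by
  have := A.two_mul_lt; omega

theorem exists_honest (A : Assumptions P honest) {S : Finset R} (hS : P.f + 1 ≤ S.card) :
    ∃ q ∈ S, q ∈ honest := by
  by_contra! h
  have h₁ : (S : Set R).ncard ≤ honestᶜ.ncard := Set.ncard_le_ncard (fun q hq => h q hq)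
  rw [Set.ncard_coe_finset] at h₁
  have := A.faulty
  omega

/-- Since `n - f > f`, the honest replicas can form any certificate without help from faulty ones.
-/
theorem honest_card (A : Assumptions P honest) : P.f + 1 ≤ honest.toFinite.toFinset.card := by
  have h₁ := Set.ncard_add_ncard_compl honest
  rw [Nat.card_eq_fintype_card, Set.ncard_eq_toFinset_card honest] at h₁
  have := A.faulty
  have := A.two_mul_lt
  omega

end Assumptions

/-- Used to pass from a fact about a state to the event that brought it about. -/
theorem exists_step {Q : ℕ → Prop} {i : ℕ} (h₀ : ¬ Q 0) (h : Q i) :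
    ∃ k < i, ¬ Q k ∧ Q (k + 1) := by
  induction i with
  | zero => exact absurd h h₀
  | succ i ih =>
    by_cases hi : Q i
    · obtain ⟨k, hk, h'⟩ := ih hi
      exact ⟨k, hk.trans (Nat.lt_succ_self i), h'⟩
    · exact ⟨i, Nat.lt_succ_self i, hi, h⟩

namespace Execution

variable {P : Protocol R Payload Id} {honest : Set R} {GST : ℝ} (X : Execution P honest GST)

/-! ### Monotonicity -/

/-- Replica `p` has started epoch `e` or a later one before event `i`. -/
def Reached (p : R) (e i : ℕ) : Prop := (X.state i p).started = true ∧ e ≤ (X.state i p).epoch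

variable {X} {p q : R} {e i j k : ℕ}

theorem grows (hp : p ∈ honest) (i : ℕ) :
    Protocol.Grows (X.time i) (fun τ => X.event i = .timeout p τ) (X.state i p)
      (X.state (i + 1) p) := (X.localStep hp i).grows

theorem received_mono (hp : p ∈ honest) (hij : i ≤ j) :
    (X.state i p).received ⊆ (X.state j p).received :=
  monotone_nat_of_le_succ (f := fun i => (X.state i p).received) (fun i => (grows hp i).received) hij

theorem outbox_mono (hp : p ∈ honest) (hij : i ≤ j) :
    (X.state i p).outbox ⊆ (X.state j p).outbox :=
  monotone_nat_of_le_succ (f := fun i => (X.state i p).outbox) (fun i => (grows hp i).outbox) hij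

theorem committed_mono (hp : p ∈ honest) (hij : i ≤ j) :
    (X.state i p).committed ⊆ (X.state j p).committed :=
  monotone_nat_of_le_succ (f := fun i => (X.state i p).committed)
    (fun i => (grows hp i).committed) hij

theorem Reached.mono (h : X.Reached p e i) (hp : p ∈ honest) (hij : i ≤ j) : X.Reached p e j := by
  induction j, hij using Nat.le_induction with
  | base => exact h
  | succ j _ ih => exact ⟨(grows hp j).started ih.1, ih.2.trans ((grows hp j).epoch_le ih.1)⟩

theorem Reached.of_le {e' : ℕ} (h : X.Reached p e i) (he : e' ≤ e) : X.Reached p e' i :=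
  ⟨h.1, he.trans h.2⟩

theorem not_reached_zero (hp : p ∈ honest) : ¬ X.Reached p e 0 := by
  simp [Reached, X.state_zero p hp, LocalState.init]

theorem reached_step_unique (hp : p ∈ honest) (h₁ : ¬ X.Reached p e i) (h₂ : X.Reached p e (i + 1))
    (h₃ : ¬ X.Reached p e j) (h₄ : X.Reached p e (j + 1)) : i = j := by
  rcases lt_trichotomy i j with h | h | h
  · exact absurd (h₂.mono hp h) h₃
  · exact h
  · exact absurd (h₄.mono hp h) h₁

theorem localInv [Fintype R] (A : Assumptions P honest) (hp : p ∈ honest) (i : ℕ) :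
    Protocol.LocalInv P p (X.state i p) := by
  induction i with
  | zero => rw [X.state_zero p hp]; exact .init
  | succ i ih => exact ih.step A.card_le (X.localStep hp i)

theorem outbox_event (hp : p ∈ honest) {x : Msg R Payload Id × ℝ} (hx : x ∈ (X.state i p).outbox) :
    ∃ k < i, x ∉ (X.state k p).outbox ∧ x ∈ (X.state (k + 1) p).outbox ∧ x.2 = X.time k := by
  obtain ⟨k, hk, h₁, h₂⟩ := exists_step (Q := fun i => x ∈ (X.state i p).outbox)
    (by simp [X.state_zero p hp, LocalState.init]) hx
  exact ⟨k, hk, h₁, h₂, ((X.localStep hp k).outbox_time h₂).resolve_left h₁⟩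

theorem outbox_finite (hp : p ∈ honest) (i : ℕ) : (X.state i p).outbox.Finite := by
  induction i with
  | zero => simp [X.state_zero p hp, LocalState.init]
  | succ i ih => exact (X.localStep hp i).outbox_finite ih

/-! ### Authenticity -/

theorem authentic_mono {m : Msg R Payload Id} (h : Authentic P honest (X.state i) m)
    (hij : i ≤ j) : Authentic P honest (X.state j) m := by
  have hv : ∀ e d q, VoteSigned honest (X.state i) e d q → VoteSigned honest (X.state j) e d q :=
    fun e d q h hq => (h hq).imp fun t ht => outbox_mono hq hij ht
  have hs : ∀ e q, SilenceSigned honest (X.state i) e q → SilenceSigned honest (X.state j) e q :=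
    fun e q h hq => (h hq).imp fun t ht => outbox_mono hq hij ht
  have hc : ∀ c, CertSigned P honest (X.state i) c → CertSigned P honest (X.state j) c := by
    intro c h
    cases c with
    | block c => exact fun q hq => hv _ _ _ (h q hq)
    | silence e S => exact fun q hq => hs _ _ (h q hq)
    | equiv e d d' => exact ⟨hv _ _ _ h.1, hv _ _ _ h.2⟩
  cases m with
  | propose e b bc => exact fun c h' => hc _ (h c h')
  | vote e d q => exact hv _ _ _ h
  | silence e q => exact hs _ _ h
  | quitEpoch c => exact hc _ h

theorem received_authentic (hp : p ∈ honest) {m : Msg R Payload Id}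
    (hm : m ∈ (X.state i p).received) : Authentic P honest (X.state i) m := by
  induction i with
  | zero => simp [X.state_zero p hp, LocalState.init] at hm
  | succ i ih =>
    refine authentic_mono ?_ (Nat.le_succ i)
    exact ((X.localStep hp i).received_auth hm).elim ih fun h => h

theorem blockCert_signed (hp : p ∈ honest) {c : BlockCert R Id}
    (hc : P.HasBlockCert (X.state i p) c) : CertSigned P honest (X.state i) (.block c) := by
  rcases hc.2 with h | h
  · exact received_authentic hp h
  · exact fun q hq => received_authentic hp (h q hq)

theorem misbehaviorCert_signed (hp : p ∈ honest) {c : Cert R Id}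
    (hc : P.HasMisbehaviorCert (X.state i p) c) : CertSigned P honest (X.state i) c := by
  cases c with
  | block c => exact hc.elim
  | silence e S =>
    rcases hc.2 with h | h
    · exact received_authentic hp h
    · exact fun q hq => received_authentic hp (h q hq)
  | equiv e d d' =>
    rcases hc.2 with h | h
    · exact received_authentic hp h
    · exact ⟨received_authentic hp h.1, received_authentic hp h.2⟩

theorem exists_honest_vote [Fintype R] (A : Assumptions P honest) {c : BlockCert R Id}
    (hw : P.WellFormed c) (hc : CertSigned P honest (X.state i) (.block c)) :
    ∃ q ∈ honest, ∃ t, (.vote c.epoch c.id q, t) ∈ (X.state i q).outbox := by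
  obtain ⟨q, hq, hqh⟩ := A.exists_honest hw
  exact ⟨q, hqh, hc q hq hqh⟩

/-! ### The end of an instant -/

theorem exists_lt_time (X : Execution P honest GST) (T : ℝ) : ∃ i, T < X.time i :=
  (X.time_tendsto.eventually_gt_atTop T).exists

open Classical in
/-- The index of the first event after time `T`. -/
noncomputable def endOf (X : Execution P honest GST) (T : ℝ) : ℕ := Nat.find (X.exists_lt_time T)

theorem lt_time_endOf (X : Execution P honest GST) (T : ℝ) : T < X.time (X.endOf T) := by
  classical exact Nat.find_spec (X.exists_lt_time T)

theorem lt_endOf {T : ℝ} : i < X.endOf T ↔ X.time i ≤ T := by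
  classical
  constructor
  · exact fun h => not_lt.1 (Nat.find_min (X.exists_lt_time T) h)
  · intro h
    by_contra h'
    exact absurd ((X.lt_time_endOf T).trans_le (X.time_mono (not_lt.1 h'))) (not_lt.2 h)

theorem endOf_le {T : ℝ} (h : T < X.time i) : X.endOf T ≤ i := by
  by_contra h'
  exact absurd (lt_endOf.1 (not_le.1 h')) (not_le.2 h)

theorem endOf_mono {T T' : ℝ} (h : T ≤ T') : X.endOf T ≤ X.endOf T' :=
  endOf_le (h.trans_lt (X.lt_time_endOf T'))

/-- Time cannot advance while a rule is enabled, and time advances past `T` at this index. Together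
with `received_endOf` this makes `endOf T` the index at which everything due by `T` has been
received and acted upon. -/
theorem not_enabled_endOf (hp : p ∈ honest) (T t : ℝ) :
    ¬ P.Enabled p t (X.state (X.endOf T) p) := by
  intro h
  -- Whether a rule is enabled does not depend on the clock, so the time can be chosen to match
  -- `urgent`.
  have h' : ∀ t', P.Enabled p t' (X.state (X.endOf T) p) := by
    intro t'
    obtain ⟨_, h⟩ := h
    cases h with
    | vote b bc h1 h2 h3 h4 h5 h6 h7 => exact ⟨_, .vote b bc h1 h2 h3 h4 h5 h6 h7⟩
    | blockCert c h1 h2 h3 => exact ⟨_, .blockCert c h1 h2 h3⟩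
    | blockCertLeader c h1 h2 h3 h4 h5 => exact ⟨_, .blockCertLeader c h1 h2 h3 h4 h5⟩
    | fastCommit e d h1 h2 h3 => exact ⟨_, .fastCommit e d h1 h2 h3⟩
    | commitBlock e b bc h1 h2 h3 h4 => exact ⟨_, .commitBlock e b bc h1 h2 h3 h4⟩
    | misbehavior c h1 h2 h3 => exact ⟨_, .misbehavior c h1 h2 h3⟩
  cases hj : X.endOf T with
  | zero =>
    obtain ⟨_, h⟩ := h' 0
    rw [hj, X.state_zero p hp] at h
    cases h <;> simp_all [LocalState.init]
  | succ j =>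
    have h₁ := X.lt_time_endOf T
    have h₂ : X.time j ≤ T := lt_endOf.1 (by omega)
    rw [hj] at h₁ h'
    have := X.urgent j p hp (h' _)
    linarith

theorem received_endOf (hp : p ∈ honest) (hq : q ∈ honest) {m : Msg R Payload Id} {t T : ℝ}
    (hm : (m, t) ∈ (X.state i p).outbox) (hT : P.deadline GST m t ≤ T)
    (hi : i ≤ X.endOf T) : m ∈ (X.state (X.endOf T) q).received :=
  X.delivery _ p hp q hq m t (outbox_mono hp hi hm) (hT.trans_lt (X.lt_time_endOf T))

theorem deadline_small {m : Msg R Payload Id} (hm : ¬ m.IsLarge) (t : ℝ) :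
    P.deadline GST m t = t + P.ΔS := by simp [Protocol.deadline, hm]

/-! ### Timers -/

/-- A timer disappears only by firing, and time, which is unbounded, cannot pass `x` while it is
running. -/
theorem timer_fires (hp : p ∈ honest) {τ : Timer Id} {x : ℝ} (h : (τ, x) ∈ (X.state i p).timers) :
    ∃ m, i ≤ m ∧ X.event m = .timeout p τ ∧ X.time m = x := by
  by_contra! hm
  have hall : ∀ j, i ≤ j → (τ, x) ∈ (X.state j p).timers := by
    intro j hj
    induction j, hj using Nat.le_induction with
    | base => exact h
    | succ j hj ih =>
      rcases (grows hp j).timers τ x ih with h | ⟨h₁, h₂⟩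
      · exact h
      · exact absurd h₁.symm (hm j hj h₂)
  obtain ⟨j, hj⟩ := X.exists_lt_time x
  have := X.timer_due _ p hp τ x (hall (max i j) (le_max_left _ _))
  have := X.time_mono (le_max_right i j)
  linarith

theorem epochTimer_event (hp : p ∈ honest) {τ : Timer Id} {x d : ℝ}
    (hx : (τ, x) ∈ (X.state i p).timers)
    (hτ : τ = .certificate e ∧ d = P.timeoutCertificate ∨
      τ = .epochChange e ∧ d = P.timeoutEpochChange) :
    ∃ k < i, ¬ X.Reached p e k ∧ X.Reached p e (k + 1) ∧ x = X.time k + d := by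
  obtain ⟨k, hk, h₁, h₂⟩ := exists_step (Q := fun i => (τ, x) ∈ (X.state i p).timers)
    (by simp [X.state_zero p hp, LocalState.init]) hx
  obtain ⟨h₃, h₄, h₅, h₆⟩ := ((X.localStep hp k).epochTimer h₂ hτ).resolve_left h₁
  exact ⟨k, hk, h₄, ⟨h₅, h₆⟩, h₃⟩

theorem commitNil_event (hp : p ∈ honest) {x : ℝ}
    (hx : (.commit e none, x) ∈ (X.state i p).timers) :
    ∃ k < i, x = X.time k + P.timeoutCommit ∧ X.Reached p e k ∧ ∃ c, c.epoch = e ∧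
      P.HasMisbehaviorCert (X.state k p) c ∧
      (.quitEpoch c, X.time k) ∈ (X.state (k + 1) p).outbox := by
  obtain ⟨k, hk, h₁, h₂⟩ := exists_step
    (Q := fun i => (Timer.commit e none, x) ∈ (X.state i p).timers)
    (by simp [X.state_zero p hp, LocalState.init]) hx
  obtain ⟨h₃, h₄, h₅, h₆⟩ := ((X.localStep hp k).commitNil h₂).resolve_left h₁
  exact ⟨k, hk, h₃, ⟨h₄, h₅.ge⟩, h₆⟩

/-- The event in which a replica starts an epoch. -/
theorem start_event (hp : p ∈ honest) (h : X.Reached p e i) :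
    ∃ k < i, ¬ X.Reached p e k ∧ X.Reached p e (k + 1) :=
  exists_step (Q := fun i => X.Reached p e i) (not_reached_zero hp) h

/-- The certificate with which a replica leaves an epoch. -/
theorem exit_event [Fintype R] (A : Assumptions P honest) (hp : p ∈ honest)
    (h : X.Reached p (e + 1) i) :
    (∃ k < i, X.Reached p e k ∧ ∃ c, c.epoch = e ∧ P.HasBlockCert (X.state k p) c ∧
      (.quitEpoch (.block c), X.time k) ∈ (X.state (k + 1) p).outbox) ∨
    (∃ k < i, X.Reached p e k ∧ ∃ c, c.epoch = e ∧ P.HasMisbehaviorCert (X.state k p) c ∧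
      (.quitEpoch c, X.time k) ∈ (X.state (k + 1) p).outbox ∧
      ∃ m < i, X.time m = X.time k + P.timeoutCommit) := by
  obtain ⟨k, hk, h₁, h₂⟩ := start_event hp h
  obtain ⟨-, -, -, -, h₃⟩ := (X.localStep hp k).start (localInv A hp k) h₁ h₂.1 h₂.2
  obtain ⟨e', he, h₄, h₅, h₆⟩ := h₃.resolve_left (by simp)
  obtain rfl : e = e' := by omega
  rcases h₆ with ⟨c, h₇, h₈, h₉, -⟩ | h₆
  · exact .inl ⟨k, hk, ⟨h₄, h₅.ge⟩, c, h₇, h₈, h₉⟩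
  · obtain ⟨m, hm, h₇, h₈, c, h₉, h₁₀, h₁₁⟩ := commitNil_event hp h₆
    exact .inr ⟨m, hm.trans hk, h₈, c, h₉, h₁₀, h₁₁, k, hk, h₇⟩

/-! ### All honest replicas start all epochs, at about the same times -/

theorem reached_succ_or_eq (h : X.Reached p e i) :
    X.Reached p (e + 1) i ∨ (X.state i p).epoch = e := by
  rcases h.2.lt_or_eq with h' | h'
  · exact .inl ⟨h.1, h'⟩
  · exact .inr h'.symm

theorem reached_succ_of_blockCert (hp : p ∈ honest) {T : ℝ} (h : X.Reached p e (X.endOf T))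
    {c : BlockCert R Id} (hc : P.HasBlockCert (X.state (X.endOf T) p) c) (he : c.epoch = e) :
    X.Reached p (e + 1) (X.endOf T) :=
  (reached_succ_or_eq h).resolve_right fun h' =>
    not_enabled_endOf hp T 0 ⟨_, .blockCert c h.1 hc (he.trans h'.symm)⟩

/-- A decision presupposes a block certificate, and with one of the current epoch the replica would
already have moved on. -/
theorem status_endOf [Fintype R] (A : Assumptions P honest) (hp : p ∈ honest) {T : ℝ}
    (h : (X.state (X.endOf T) p).started = true) (he : (X.state (X.endOf T) p).epoch = e) :
    (X.state (X.endOf T) p).status e = some .active ∨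
      (X.state (X.endOf T) p).status e = some .notCommitted := by
  have I := localInv (X := X) A hp (X.endOf T)
  cases hs : (X.state (X.endOf T) p).status e with
  | none => exact absurd ((I.status_none h e).1 hs) (by omega)
  | some σ =>
    cases σ with
    | active => exact .inl rfl
    | notCommitted => exact .inr rfl
    | committed =>
      obtain ⟨d, hd⟩ := I.committed e hs
      obtain ⟨c, hc, -, hc'⟩ := I.decided e d hd
      have := (reached_succ_of_blockCert hp ⟨h, he.ge⟩ hc' hc).2
      omega

/-- A replica still in `e` must have marked it not-committed by the end of instant `T`. Its nil
timer was thus started by `T`, and its expiry at most `2 ΔS` later ends the epoch if nothing else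
has. -/
theorem reached_succ_of_misbehaviorCert [Fintype R] (A : Assumptions P honest) (hp : p ∈ honest)
    {T : ℝ} (h : X.Reached p e (X.endOf T)) {c : Cert R Id}
    (hc : P.HasMisbehaviorCert (X.state (X.endOf T) p) c) (he : c.epoch = e) :
    X.Reached p (e + 1) (X.endOf (T + 2 * P.ΔS)) := by
  have hΔ := A.ΔS_pos
  rcases reached_succ_or_eq h with h' | h'
  · exact h'.mono hp (endOf_mono (by linarith))
  rcases status_endOf A hp h.1 h' with hs | hs
  · exact absurd ⟨_, .misbehavior c h.1 hc (by rw [he]; exact hs)⟩ (not_enabled_endOf hp T 0)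
  obtain ⟨x, hx⟩ := (localInv (X := X) A hp (X.endOf T)).commitNil h.1 (by rw [h']; exact hs)
  rw [h'] at hx
  obtain ⟨k, hk, h₁, -⟩ := commitNil_event hp hx
  obtain ⟨m, hm, h₂, h₃⟩ := timer_fires hp hx
  have hk' := lt_endOf.1 hk
  have hm' : m < X.endOf (T + 2 * P.ΔS) := lt_endOf.2 (by
    rw [h₃, h₁, Protocol.timeoutCommit]; linarith)
  refine Reached.mono ?_ hp hm'
  have hr : X.Reached p e m := h.mono hp hm
  rcases reached_succ_or_eq hr with h₄ | h₄
  · exact h₄.mono hp (Nat.le_succ m)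
  · have h₅ := (X.timeout_step m p hp _ h₂).2
    simp only [Protocol.timeoutStep, Protocol.onTimeout, h₄, if_true] at h₅
    simp [Reached, h₅]

/-- Bootstrapping requires an unstarted replica and `started` is never reset. So it happens only
once, and before any state in which the replica has started. -/
theorem exists_bootstrap (hp : p ∈ honest) (h : (X.state i p).started = true) :
    ∃ k < i, X.event k = .bootstrap p ∧ ∀ j, X.event j = .bootstrap p → j = k := by
  obtain ⟨t₀, ht₀⟩ := X.start
  obtain ⟨k, hk, -, -⟩ := ht₀ p hp
  have hu : ∀ j k, X.event j = .bootstrap p → X.event k = .bootstrap p → j ≤ k := by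
    intro j k hj hk
    by_contra! hlt
    have h₁ : X.Reached p 0 (k + 1) := by
      simp [Reached, (X.bootstrap_step k p hp hk).2]
    have h₂ := (h₁.mono hp (Nat.succ_le_of_lt hlt)).1
    rw [(X.bootstrap_step j p hp hj).1] at h₂
    exact absurd h₂ (by simp)
  refine ⟨k, ?_, hk, fun j hj => le_antisymm (hu _ _ hj hk) (hu _ _ hk hj)⟩
  by_contra! hik
  have h₁ : X.Reached p 0 i := ⟨h, Nat.zero_le _⟩
  have h₂ := (h₁.mono hp hik).1
  rw [(X.bootstrap_step k p hp hk).1] at h₂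
  exact absurd h₂ (by simp)

/-- Honest replicas start an epoch within `Δ_S` time of each other. -/
theorem reached_sync [Fintype R] (A : Assumptions P honest) (e : ℕ) :
    ∀ {p q : R} {i : ℕ}, p ∈ honest → q ∈ honest → X.Reached p e (i + 1) →
      X.Reached q e (X.endOf (X.time i + P.ΔS)) := by
  have hΔ := A.ΔS_pos
  induction e with
  | zero =>
    intro p q i hp hq h
    obtain ⟨k, hk, -, hk'⟩ := exists_bootstrap hp h.1
    obtain ⟨t₀, ht₀⟩ := X.start
    obtain ⟨k₁, h₁, h₂, -⟩ := ht₀ p hp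
    obtain ⟨k₂, h₃, -, h₄⟩ := ht₀ q hq
    obtain rfl := hk' k₁ h₁
    have hki : X.time k₁ ≤ X.time i := X.time_mono (by omega)
    have h₅ : X.Reached q 0 (k₂ + 1) := by
      simp [Reached, (X.bootstrap_step k₂ q hq h₃).2]
    exact h₅.mono hq (lt_endOf.2 (by linarith))
  | succ e ih =>
    intro p q i hp hq h
    rcases exit_event A hp h with ⟨k, hk, hr, c, hce, hc, hm⟩ |
      ⟨k, hk, hr, c, hce, hc, hm, m, hm₁, hm₂⟩
    -- By `ΔS` after the certificate is broadcast, `q` has both entered `e`, by induction, and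
    -- received the certificate.
    · have hk' : X.time k ≤ X.time i := X.time_mono (by omega)
      have h₁ := ih hp hq (hr.mono hp (Nat.le_succ k))
      refine Reached.mono (reached_succ_of_blockCert hq h₁ (c := c) ⟨hc.1, .inl ?_⟩ hce) hq
        (endOf_mono (by linarith))
      exact received_endOf hp hq hm (deadline_small (by simp [Msg.IsLarge]) _).le
        (lt_endOf.2 (by linarith))
    -- `q` holds the certificate in epoch `e` by `ΔS` after `p` used it. Both pause for `2 ΔS`, so
    -- the lag stays at most `ΔS`.
    · have hm' : X.time m ≤ X.time i := X.time_mono (by omega)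
      have h₁ := ih hp hq (hr.mono hp (Nat.le_succ k))
      have h₂ : Msg.quitEpoch c ∈ (X.state (X.endOf (X.time k + P.ΔS)) q).received :=
        received_endOf hp hq hm (deadline_small (by simp [Msg.IsLarge]) _).le
          (lt_endOf.2 (by linarith))
      have hc' : P.HasMisbehaviorCert (X.state (X.endOf (X.time k + P.ΔS)) q) c := by
        cases c with
        | block c => exact hc
        | silence e S => exact ⟨hc.1, .inl h₂⟩
        | equiv e d d' => exact ⟨hc.1, .inl h₂⟩
      refine (reached_succ_of_misbehaviorCert A hq h₁ hc' hce).mono hq (endOf_mono ?_)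
      rw [Protocol.timeoutCommit] at hm₂
      linarith

theorem exists_honest_mem [Fintype R] (A : Assumptions P honest) : ∃ p, p ∈ honest := by
  obtain ⟨p, -, hp⟩ := A.exists_honest (S := Finset.univ) A.card_le
  exact ⟨p, hp⟩

/-- A replica that stays in an epoch signs a silence message. -/
theorem exists_silence [Fintype R] (A : Assumptions P honest) (hp : p ∈ honest)
    (h : X.Reached p e i) (hn : ∀ j, ¬ X.Reached p (e + 1) j) :
    ∃ j t, (.silence e p, t) ∈ (X.state j p).outbox := by
  obtain ⟨k, hk, h₁, h₂⟩ := start_event hp h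
  obtain ⟨-, -, h₃, -⟩ := (X.localStep hp k).start (localInv A hp k) h₁ h₂.1 h₂.2
  obtain ⟨m, hm, h₄, h₅⟩ := timer_fires hp h₃
  have hr : X.Reached p e m := h₂.mono hp hm
  have he : (X.state m p).epoch = e := (reached_succ_or_eq hr).resolve_left (hn m)
  have I := localInv (X := X) A hp m
  have hme : m ≤ X.endOf (X.time m) := (lt_endOf.2 le_rfl).le
  -- When `timeoutCertificate` expires the epoch is still active: any other status of it comes with
  -- a certificate that would make the replica leave.
  cases hs : (X.state m p).status e with
  | none => exact absurd ((I.status_none hr.1 e).1 hs) (by omega)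
  | some σ =>
    cases σ with
    | active =>
      refine ⟨m + 1, X.time m, ?_⟩
      have h₆ := (X.timeout_step m p hp _ h₄).2
      simp only [Protocol.timeoutStep, Protocol.onTimeout, he, hs, and_self, if_true] at h₆
      rw [h₆]
      exact Set.mem_insert _ _
    | notCommitted =>
      obtain ⟨c, hc, hc'⟩ := I.notCommitted e hs
      exact absurd (reached_succ_of_misbehaviorCert A hp (hr.mono hp hme)
        (hc'.mono (received_mono hp hme)) hc) (hn _)
    | committed =>
      obtain ⟨d, hd⟩ := I.committed e hs
      obtain ⟨c, hc, -, hc'⟩ := I.decided e d hd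
      exact absurd (reached_succ_of_blockCert hp (hr.mono hp hme)
        (hc'.mono (received_mono hp hme)) hc) (hn _)

theorem eventually_received (hp : p ∈ honest) (hq : q ∈ honest) {m : Msg R Payload Id} {t : ℝ}
    (hm : (m, t) ∈ (X.state i p).outbox) :
    ∀ᶠ T in atTop, m ∈ (X.state (X.endOf T) q).received := by
  filter_upwards [eventually_ge_atTop (P.deadline GST m t), eventually_ge_atTop (X.time i)]
    with T h₁ h₂
  exact received_endOf hp hq hm h₁ (lt_endOf.2 h₂).le

theorem eventually_of_index {Q : ℕ → Prop} (h : ∀ j, i ≤ j → Q j) :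
    ∀ᶠ T in atTop, Q (X.endOf T) := by
  filter_upwards [eventually_ge_atTop (X.time i)] with T hT
  exact h _ (lt_endOf.2 hT).le

/-- Every honest replica starts every epoch. -/
theorem exists_reached [Fintype R] (A : Assumptions P honest) (e : ℕ) :
    ∀ p ∈ honest, ∃ i, X.Reached p e i := by
  induction e with
  | zero =>
    intro p hp
    obtain ⟨t₀, ht₀⟩ := X.start
    obtain ⟨k, hk, -⟩ := ht₀ p hp
    exact ⟨k + 1, by simp [Reached, (X.bootstrap_step k p hp hk).2]⟩
  | succ e ih =>
    -- By `reached_sync`, one replica that leaves the epoch takes all others along.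
    suffices h : ∃ p ∈ honest, ∃ i, X.Reached p (e + 1) i by
      obtain ⟨p, hp, i, hi⟩ := h
      intro q hq
      obtain ⟨k, -, -, hk⟩ := start_event hp hi
      exact ⟨_, reached_sync A (e + 1) hp hq hk⟩
    by_contra! hn
    obtain ⟨p, hp⟩ := exists_honest_mem A
    obtain ⟨i, hi⟩ := ih p hp
    have hsil : ∀ᶠ T in atTop, ∀ q : R, q ∈ honest →
        .silence e q ∈ (X.state (X.endOf T) p).received := by
      rw [eventually_all]
      intro q
      by_cases hq : q ∈ honest
      · obtain ⟨i, hi⟩ := ih q hq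
        obtain ⟨j, t, hj⟩ := exists_silence A hq hi (hn q hq)
        exact (eventually_received hq hp hj).mono fun _ h _ => h
      · exact .of_forall fun _ h => absurd h hq
    obtain ⟨T, hT, hr⟩ := (hsil.and (eventually_of_index (X := X) (Q := X.Reached p e)
      fun j hj => hi.mono hp hj)).exists
    refine hn p hp _ (reached_succ_of_misbehaviorCert A hp hr
      (c := .silence e honest.toFinite.toFinset) ⟨A.honest_card, .inr fun q hq => ?_⟩ rfl)
    exact hT q (by simpa using hq)

/-! ### Votes of honest replicas -/

/-- The rule for `epochChange` proposes without consulting `hasVoted`. That a waiting leader cannot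
have voted already has to be derived, and it is what keeps an honest leader from equivocating. -/
theorem epochChange_not_voted [Fintype R] (A : Assumptions P honest) (hp : p ∈ honest) {x : ℝ} :
    ∀ i, (.epochChange e, x) ∈ (X.state i p).timers →
      ∀ d t, (.vote e d p, t) ∉ (X.state i p).outbox := by
  intro i
  induction i with
  | zero => simp [X.state_zero p hp, LocalState.init]
  | succ i ih =>
    intro hx d t hv
    have L := X.localStep hp i
    have I := localInv (X := X) A hp i
    by_cases hold : (.vote e d p, t) ∈ (X.state i p).outbox
    · obtain ⟨h₁, h₂, -⟩ := I.voted _ _ _ hold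
      rcases L.epochTimer hx (.inr ⟨rfl, rfl⟩) with h | ⟨-, h, -⟩
      · exact ih h d t hold
      · exact h ⟨h₁, h₂⟩
    obtain ⟨-, -, -, b, bc, rfl, -, -, -, h | ⟨-, -, -, ⟨h, -, h'⟩ | ⟨h₁, h₂, h₃, -, h₄⟩⟩⟩ :=
      L.vote I hold hv
    -- Casting a vote needs the vote of the leader, here `p` itself. By authenticity `p` would have
    -- signed it earlier, while the timer was running.
    · rcases L.epochTimer hx (.inr ⟨rfl, rfl⟩) with hx' | ⟨-, h', -⟩
      · obtain ⟨-, hl, -⟩ := I.epochChange _ _ hx'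
        have ha := received_authentic hp h.2.2.2.2.2
        rw [hl] at ha
        obtain ⟨t', ht'⟩ := ha hp
        exact ih hx' _ _ ht'
      · exact h' ⟨h.1, h.2.1.ge⟩
    · obtain ⟨h₁, -, h₂⟩ := I.epochChange _ _ (h' x hx)
      exact h ⟨h₁, h₂⟩
    -- The expired timer is removed. No second one for `e` can remain, because the single entry into
    -- `e` fixes the expiry time.
    · rw [h₄] at hx
      obtain ⟨k, -, hk₁, hk₂, rfl⟩ := epochTimer_event hp hx.1 (.inr ⟨rfl, rfl⟩)
      obtain ⟨k', -, hk₁', hk₂', h₅⟩ := epochTimer_event hp h₂ (.inr ⟨rfl, rfl⟩)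
      obtain rfl := reached_step_unique hp hk₁ hk₂ hk₁' hk₂'
      exact hx.2 (by rw [← h₅]; rfl)

/-- An honest replica signs at most one vote in each epoch. -/
theorem vote_unique [Fintype R] (A : Assumptions P honest) (hp : p ∈ honest) {d d' : Id}
    {t t' : ℝ} (h : (.vote e d p, t) ∈ (X.state i p).outbox)
    (hv : (.vote e d' p, t') ∈ (X.state i p).outbox) : d = d' := by
  -- After a vote in `e`, each way of signing another is closed: `hasVoted` blocks the voting rule,
  -- `e` cannot be entered again, and no `epochChange` timer for `e` is running.
  have key : ∀ k, ∀ d d' t t', (.vote e d p, t) ∈ (X.state k p).outbox →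
      (.vote e d' p, t') ∉ (X.state k p).outbox →
      (.vote e d' p, t') ∉ (X.state (k + 1) p).outbox := by
    intro k d d' t t' h₁ h₂ h₃
    have I := localInv (X := X) A hp k
    obtain ⟨h₄, h₅, h₆⟩ := I.voted _ _ _ h₁
    obtain ⟨-, -, -, b, bc, -, -, -, -, h | ⟨-, -, -, ⟨h, -⟩ | ⟨-, h, -⟩⟩⟩ :=
      (X.localStep hp k).vote I h₂ h₃
    · simp [h.2.2.1, h.2.1] at h₆
    · exact h ⟨h₄, h₅⟩
    · exact epochChange_not_voted A hp k h _ _ h₁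
  induction i with
  | zero => simp [X.state_zero p hp, LocalState.init] at h
  | succ i ih =>
    by_cases h₁ : (.vote e d p, t) ∈ (X.state i p).outbox <;>
      by_cases h₂ : (.vote e d' p, t') ∈ (X.state i p).outbox
    · exact ih h₁ h₂
    · exact absurd hv (key i _ _ _ _ h₁ h₂)
    · exact absurd h (key i _ _ _ _ h₂ h₁)
    · exact (X.localStep hp i).vote_unique h₁ h h₂ hv

/-- A vote in an epoch with an honest leader is for the hash that the leader voted for. -/
theorem leader_voted [Fintype R] (A : Assumptions P honest) (hp : p ∈ honest) {d : Id} {t : ℝ}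
    (hl : P.leader e ∈ honest) (h : (.vote e d p, t) ∈ (X.state i p).outbox) :
    ∃ t', (.vote e d (P.leader e), t') ∈ (X.state i (P.leader e)).outbox := by
  obtain ⟨k, hk, h₁, h₂, h₃⟩ := outbox_event hp h
  obtain ⟨-, -, -, b, bc, -, -, -, -, hcast | ⟨hlead, -⟩⟩ :=
    (X.localStep hp k).vote (localInv A hp k) h₁ h₂
  · exact (received_authentic hp hcast.2.2.2.2.2 hl).imp fun t ht => outbox_mono hl hk.le ht
  · exact ⟨t, hlead ▸ h⟩

/-- The blocks that honest replicas vote for are valid. -/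
theorem voted_valid [Fintype R] (A : Assumptions P honest) : ∀ i, ∀ p ∈ honest, ∀ e d t,
    (.vote e d p, t) ∈ (X.state i p).outbox → ∃ a, P.valid a ∧ P.id a = d := by
  intro i
  induction i with
  | zero => intro p hp; simp [X.state_zero p hp, LocalState.init]
  | succ i ih =>
    intro p hp e d t h
    by_cases hold : (.vote e d p, t) ∈ (X.state i p).outbox
    · exact ih p hp e d t hold
    obtain ⟨-, -, -, b, bc, rfl, hb, -, -, h' | ⟨-, rfl, hc, -⟩⟩ :=
      (X.localStep hp i).vote (localInv A hp i) hold h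
    · exact ⟨b, h'.2.2.2.1.1, rfl⟩
    -- The certificate for the predecessor contains an earlier honest vote, so by induction the
    -- predecessor is valid and the payload assumption applies.
    · refine ⟨_, A.payload p hp e (bc.map BlockCert.id) ?_, rfl⟩
      intro d hd
      obtain ⟨c, hc', rfl⟩ := Option.map_eq_some_iff.1 hd
      have hc'' := hc c hc'
      obtain ⟨q, hq, t, ht⟩ := exists_honest_vote A hc''.1 (blockCert_signed hp hc'')
      exact ih q hq _ _ _ ht

/-! ### Epochs with an honest leader -/

/-- No honest replica has signed a silence message of epoch `e` before event `i`. -/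
def NoSilence (X : Execution P honest GST) (e i : ℕ) : Prop :=
  ∀ q ∈ honest, ∀ t, (.silence e q, t) ∉ (X.state i q).outbox

theorem NoSilence.mono (h : X.NoSilence e j) (hij : i ≤ j) : X.NoSilence e i :=
  fun q hq t ht => h q hq t (outbox_mono hq hij ht)

/-- A silence certificate needs an honest signer, and an equivocation certificate needs two
different votes of the honest leader. -/
theorem NoSilence.not_misbehaviorCert [Fintype R] (A : Assumptions P honest)
    (hl : P.leader e ∈ honest) (h : X.NoSilence e i) (hp : p ∈ honest) {c : Cert R Id}
    (hc : P.HasMisbehaviorCert (X.state i p) c) : c.epoch ≠ e := by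
  rintro rfl
  have hs := misbehaviorCert_signed hp hc
  cases c with
  | block c => exact hc
  | silence e S =>
    obtain ⟨q, hq, hq'⟩ := A.exists_honest hc.1
    obtain ⟨t, ht⟩ := hs q hq hq'
    exact h q hq' t ht
  | equiv e d d' =>
    obtain ⟨t, ht⟩ := hs.1 hl
    obtain ⟨t', ht'⟩ := hs.2 hl
    exact hc.1 (vote_unique A hl ht ht')

theorem NoSilence.exit_event [Fintype R] (A : Assumptions P honest) (hl : P.leader e ∈ honest)
    (hn : X.NoSilence e i) (hp : p ∈ honest) (h : X.Reached p (e + 1) i) :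
    ∃ k < i, X.Reached p e k ∧ ∃ c, c.epoch = e ∧ P.HasBlockCert (X.state k p) c ∧
      (.quitEpoch (.block c), X.time k) ∈ (X.state (k + 1) p).outbox := by
  rcases Execution.exit_event A hp h with h' | ⟨k, hk, -, c, hc, hc', -⟩
  · exact h'
  · exact absurd hc ((hn.mono hk.le).not_misbehaviorCert A hl hp hc')

theorem leader_voted_of_blockCert [Fintype R] (A : Assumptions P honest)
    (hl : P.leader e ∈ honest) (hp : p ∈ honest) {c : BlockCert R Id}
    (hc : P.HasBlockCert (X.state i p) c) (he : c.epoch = e) :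
    ∃ t, (.vote e c.id (P.leader e), t) ∈ (X.state i (P.leader e)).outbox := by
  obtain ⟨q, hq, t, ht⟩ := exists_honest_vote A hc.1 (blockCert_signed hp hc)
  subst he
  exact leader_voted A hq hl ht

/-- An honest leader votes within `2 Δ_S` from its start of the epoch. -/
theorem NoSilence.leader_votes [Fintype R] (A : Assumptions P honest) (hl : P.leader e ∈ honest)
    {T : ℝ} (hn : X.NoSilence e (X.endOf T)) (h₀ : ¬ X.Reached (P.leader e) e k)
    (h₁ : X.Reached (P.leader e) e (k + 1)) (hT : X.time k + 2 * P.ΔS ≤ T) :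
    ∃ d t, (.vote e d (P.leader e), t) ∈ (X.state (X.endOf T) (P.leader e)).outbox := by
  have hΔ := A.ΔS_pos
  obtain ⟨-, -, -, h₂, -⟩ := (X.localStep hl k).start (localInv A hl k) h₀ h₁.1 h₁.2
  rcases h₂ rfl with ⟨b, bc, hb⟩ | h₂
  · exact ⟨_, _, outbox_mono hl (lt_endOf.2 (by linarith))
      ((localInv A hl (k + 1)).proposed _ _ _ _ hb)⟩
  · obtain ⟨m, hm, h₃, h₄⟩ := timer_fires hl h₂
    have hmT : m < X.endOf T := lt_endOf.2 (by rw [h₄]; exact hT)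
    rcases reached_succ_or_eq (h₁.mono hl hm) with h₅ | h₅
    · obtain ⟨k', hk', -, c, hc, hc', -⟩ := (hn.mono hmT.le).exit_event A hl hl h₅
      obtain ⟨t, ht⟩ := leader_voted_of_blockCert A hl hl hc' hc
      exact ⟨_, t, outbox_mono hl (hk'.trans hmT).le ht⟩
    · have h₆ := (X.timeout_step m _ hl _ h₃).2
      simp only [Protocol.timeoutStep, Protocol.onTimeout, h₅, if_true] at h₆
      have h₇ : ∃ d, (.vote e d (P.leader e), X.time m) ∈ (X.state (m + 1) (P.leader e)).outbox := by
        rw [h₆]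
        exact ⟨_, Set.mem_insert _ _⟩
      obtain ⟨d, hd⟩ := h₇
      exact ⟨d, _, outbox_mono hl hmT hd⟩

/-- The proposal behind the vote of an honest leader. -/
theorem leader_proposal [Fintype R] (A : Assumptions P honest) (hl : P.leader e ∈ honest) {d : Id}
    {t : ℝ} (h : (.vote e d (P.leader e), t) ∈ (X.state i (P.leader e)).outbox) :
    ∃ k < i, t = X.time k ∧ X.Reached (P.leader e) e (k + 1) ∧ ∃ b bc, d = P.id b ∧
      P.ValidProposal b bc ∧ (.propose e b bc, t) ∈ (X.state (k + 1) (P.leader e)).outbox ∧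
      ((e = 0 ∨ ∃ c ∈ bc, c.epoch + 1 = e) ∨
        (X.event k = .timeout (P.leader e) (.epochChange e) ∧
          (.epochChange e, X.time k) ∈ (X.state k (P.leader e)).timers ∧
          (X.state k (P.leader e)).epoch = e ∧ bc = (X.state k (P.leader e)).lockedBC)) := by
  obtain ⟨k, hk, h₁, h₂, h₃⟩ := outbox_event hl h
  have I := localInv (X := X) A hl k
  obtain ⟨-, hs, he, b, bc, rfl, hb, hpr, -, h' | ⟨-, rfl, hc, h'⟩⟩ :=
    (X.localStep hl k).vote I h₁ h₂
  -- The leader cannot use the voting rule: it would already need its own vote, contrary to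
  -- `hasVoted = false`.
  · obtain ⟨t', ht'⟩ := received_authentic hl h'.2.2.2.2.2 hl
    have := (I.voted _ _ _ ht').2.2 h'.2.1.symm
    simp [h'.2.2.1] at this
  · refine ⟨k, hk, h₃, ⟨hs, he.ge⟩, _, bc, rfl, ⟨?_, hb, fun c hc' => (hc c hc').1⟩, hpr, ?_⟩
    · obtain ⟨a, ha, ha'⟩ := voted_valid A _ _ hl _ _ _ h
      rwa [← A.id_injective ha']
    · exact h'.imp (fun h => h.2.1) fun h => ⟨h.1, h.2.1, h.2.2.1, h.2.2.2.1⟩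

theorem afterGST_le [Fintype R] (A : Assumptions P honest) (hG : X.AfterGST e) (hp : p ∈ honest)
    (h : X.Reached p e (k + 1)) : GST ≤ X.time k := by
  obtain ⟨m, hm, h₁, h₂⟩ := start_event hp h
  obtain ⟨h₃, -⟩ := (X.localStep hp m).start (localInv A hp m) h₁ h₂.1 h₂.2
  refine (hG p hp m ⟨fun h => h₁ ⟨h.1, h.2.ge⟩, h₂.1, h₃⟩).trans (X.time_mono (by omega))

/-- The lock of a replica that does not lead its epoch is constant during the epoch. -/
theorem lockedBC_eq (hp : p ∈ honest) (hne : P.leader e ≠ p) (hij : i ≤ j) (hi : X.Reached p e i)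
    (hj : (X.state j p).epoch = e) :
    (X.state j p).lockedBC = (X.state i p).lockedBC := by
  have hall : ∀ m, i ≤ m → m ≤ j → (X.state m p).epoch = e := fun m h₁ h₂ =>
    le_antisymm (hj ▸ (Reached.mono (e := (X.state m p).epoch)
      ⟨(hi.mono hp h₁).1, le_rfl⟩ hp h₂).2) (hi.mono hp h₁).2
  induction j, hij using Nat.le_induction with
  | base => rfl
  | succ j hij ih =>
    have h₁ := hall j hij (Nat.le_succ j)
    rw [← ih h₁ fun m h₁ h₂ => hall m h₁ (h₂.trans (Nat.le_succ j))]
    exact (X.localStep hp j).lockedBC_eq (hj.trans h₁.symm) (by rwa [h₁])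

/-- The certificate in a proposal that an honest leader makes after waiting is at least as recent as
the locks of the other honest replicas. -/
theorem proposal_recent [Fintype R] (A : Assumptions P honest) (hl : P.leader e ∈ honest)
    (hq : q ∈ honest) (hne : P.leader e ≠ q)
    (hev : X.event k = .timeout (P.leader e) (.epochChange e))
    (htimer : (.epochChange e, X.time k) ∈ (X.state k (P.leader e)).timers)
    (hep : (X.state k (P.leader e)).epoch = e) {c₀ : BlockCert R Id} (hij : k ≤ j)
    (hj : (X.state j q).epoch = e) (hc₀ : (X.state j q).lockedBC = some c₀) (hlt : c₀.epoch < e) :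
    ∃ c, (X.state k (P.leader e)).lockedBC = some c ∧ c₀.epoch ≤ c.epoch := by
  have hΔ := A.ΔS_pos
  obtain ⟨m, hm, h₁, h₂, h₃⟩ := epochTimer_event hl htimer (.inr ⟨rfl, rfl⟩)
  rw [Protocol.timeoutEpochChange] at h₃
  have h₄ := reached_sync A e hl hq h₂
  have h₅ : X.endOf (X.time m + P.ΔS) ≤ k := endOf_le (by linarith)
  -- From `ΔS` after the leader's entry on, `q` is in `e` and its lock is frozen. The lock was
  -- broadcast by then and reaches the leader no later than the expiry at `2 ΔS`; a tie is settled
  -- by `delivery_before_timeout`.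
  rw [lockedBC_eq hq hne (h₅.trans hij) h₄ hj] at hc₀
  obtain ⟨hcert, t, ht⟩ := (localInv A hq _).locked _ hc₀
  obtain ⟨n, hn, -, -, h₆⟩ := outbox_event hq ht
  have h₇ := lt_endOf.1 hn
  have h₈ := X.delivery_before_timeout k q hq _ hl _ t _ (outbox_mono hq h₅ ht) hev (by
    rw [deadline_small (by simp [Msg.IsLarge])]
    simp only at h₆
    linarith)
  by_contra! hc
  exact X.react_before_timeout k _ hl _ hev ⟨_, .blockCertLeader c₀
    ((localInv A hl k).started_of_timer htimer) ⟨hcert.1, .inl h₈⟩ (by omega) (by rw [hep])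
    fun c hlock => hc c hlock⟩

/-- In an epoch after GST with an honest leader, no honest replica signs a silence message. -/
theorem noSilence [Fintype R] (A : Assumptions P honest) (hl : P.leader e ∈ honest)
    (hG : X.AfterGST e) (i : ℕ) : X.NoSilence e i := by
  have hΔ := A.ΔS_pos
  have hΔL := A.ΔS_le
  induction i with
  | zero => intro q hq; simp [X.state_zero q hq, LocalState.init]
  | succ i ih =>
    intro p hp t ht
    obtain ⟨-, hev, htimer, hep⟩ := ((X.localStep hp i).silence ht).resolve_left (ih p hp t)
    have hno := X.react_before_timeout i p hp _ hev
    have hst := (localInv A hp i).started_of_timer htimer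
    obtain ⟨k, hk, h₁, h₂, h₃⟩ := epochTimer_event hp htimer (.inl ⟨rfl, rfl⟩)
    rw [Protocol.timeoutCertificate] at h₃
    obtain ⟨T, hT⟩ : ∃ T, T = X.time k + 3 * P.ΔS + P.ΔL := ⟨_, rfl⟩
    have hTi : X.endOf T ≤ i := endOf_le (by linarith)
    -- Messages are acted upon before the timer, so a block certificate of `e` at `p` is the
    -- contradiction to aim for.
    have hcert : ∀ c, P.HasBlockCert (X.state i p) c → c.epoch ≠ e := fun c hc he =>
      hno ⟨_, .blockCert c hst hc (he.trans hep.symm)⟩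
    have hreach : ∀ q ∈ honest, X.Reached q e (X.endOf T) := fun q hq =>
      (reached_sync A e hp hq h₂).mono hq (endOf_mono (by linarith))
    -- nobody has left the epoch
    have hstay : ∀ q ∈ honest, (X.state (X.endOf T) q).epoch = e := by
      intro q hq
      refine (reached_succ_or_eq (hreach q hq)).resolve_left fun h => ?_
      obtain ⟨m, hm, -, c, hc, hc', hbc⟩ := (ih.mono hTi).exit_event A hl hq h
      have hm' := lt_endOf.1 hm
      refine hcert c ⟨hc'.1, .inl ?_⟩ hc
      refine X.delivery_before_timeout i q hq p hp _ _ _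
        (outbox_mono hq (Nat.succ_le_of_lt (hm.trans_le hTi)) hbc) hev ?_
      rw [deadline_small (by simp [Msg.IsLarge])]
      linarith
    -- the leader has proposed
    have hlr := reached_sync A e hp hl h₂
    obtain ⟨k', hk', h₄, h₅⟩ := start_event hl hlr
    have hk'' := lt_endOf.1 hk'
    have hT3 : X.endOf (X.time k + 3 * P.ΔS) ≤ X.endOf T := endOf_mono (by linarith)
    obtain ⟨d, t', hd⟩ := (ih.mono (hT3.trans hTi)).leader_votes A hl h₄ h₅ (by linarith)
    obtain ⟨m, hm, rfl, h₆, b, bc, rfl, hval, hpr, hprov⟩ := leader_proposal A hl hd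
    have hm' := lt_endOf.1 hm
    have hGST := afterGST_le A hG hl h₆
    -- everybody has voted
    have hvote : ∀ q ∈ honest, ∃ t ≤ T,
        (.vote e (P.id b) q, t) ∈ (X.state (X.endOf T) q).outbox := by
      intro q hq
      have I := localInv (X := X) A hq (X.endOf T)
      have hqe := hstay q hq
      have hqs := (hreach q hq).1
      have hno' := not_enabled_endOf (X := X) hq T 0
      cases hv : (X.state (X.endOf T) q).hasVoted with
      | true =>
        obtain ⟨d, t, hdt⟩ := I.hasVoted hv
        rw [hqe] at hdt
        obtain ⟨t₂, ht₂⟩ := leader_voted A hq hl hdt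
        obtain rfl := vote_unique A hl ht₂ (outbox_mono hl hT3 hd)
        obtain ⟨n, hn, -, -, h⟩ := outbox_event hq hdt
        exact ⟨t, h.trans_le (lt_endOf.1 hn), hdt⟩
      | false =>
        exfalso
        have hne : P.leader e ≠ q := by
          rintro rfl
          have := (I.voted _ _ _ (outbox_mono hl hT3 hd)).2.2 hqe.symm
          simp [hv] at this
        have hact : (X.state (X.endOf T) q).status e = some .active := by
          refine (status_endOf A hq hqs hqe).resolve_right fun h => ?_
          obtain ⟨c, hc, hc'⟩ := I.notCommitted e h
          exact (ih.mono hTi).not_misbehaviorCert A hl hq hc' hc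
        have hrp : .propose e b bc ∈ (X.state (X.endOf T) q).received := by
          refine received_endOf hl hq hpr ?_ ((Nat.succ_le_of_lt hm).trans hT3)
          simp only [Protocol.deadline, Msg.IsLarge, if_true, max_eq_left hGST]
          linarith
        have hrv : .vote e (P.id b) (P.leader e) ∈ (X.state (X.endOf T) q).received := by
          refine received_endOf hl hq hd ?_ hT3
          rw [deadline_small (by simp [Msg.IsLarge])]
          linarith
        refine hno' ⟨_, .vote b bc hqs (by rwa [hqe]) (by rwa [hqe]) (by rwa [hqe]) hval hv ?_⟩
        cases hlock : (X.state (X.endOf T) q).lockedBC with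
        | none => exact .inl rfl
        | some c₀ =>
          obtain ⟨hc₀, -⟩ := I.locked _ hlock
          -- An honest signer of the lock is still in `e`, so the lock is not from a later epoch. A
          -- certificate of `e` itself would have made `q` leave.
          have hlt : c₀.epoch < e := by
            obtain ⟨r, hr, t, hrt⟩ := exists_honest_vote A hc₀.1 (blockCert_signed hq hc₀)
            have hle := ((localInv A hr _).voted _ _ _ hrt).2.1
            rw [hstay r hr] at hle
            refine lt_of_le_of_ne hle fun h => ?_
            exact hno' ⟨_, .blockCert c₀ hqs hc₀ (h.trans hqe.symm)⟩
          refine .inr ⟨c₀, ?_⟩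
          -- In epoch 0 there is no older lock; an immediate proposal carries a certificate of `e -
          -- 1`, the newest possible; a delayed one has seen the lock of `q`.
          rcases hprov with (h | ⟨c, hc, hce⟩) | ⟨h₇, h₈, h₉, h₁₀⟩
          · omega
          · exact ⟨c, rfl, hc, by omega⟩
          · obtain ⟨c, hc, hle⟩ := proposal_recent A hl hq hne h₇ h₈ h₉ (hm.le.trans hT3) hqe
              hlock hlt
            exact ⟨c, rfl, h₁₀.trans hc, hle⟩
    refine hcert ⟨e, P.id b, honest.toFinite.toFinset⟩ ⟨A.honest_card, .inr fun q hq => ?_⟩ rfl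
    have hq : q ∈ honest := by simpa using hq
    obtain ⟨t, ht, hqt⟩ := hvote q hq
    refine X.delivery_before_timeout i q hq p hp _ _ _ (outbox_mono hq hTi hqt) hev ?_
    rw [deadline_small (by simp [Msg.IsLarge])]
    linarith

/-- In an epoch with an honest leader, only the block that the leader proposes is voted for. -/
theorem vote_eq [Fintype R] (A : Assumptions P honest) (hl : P.leader e ∈ honest)
    {b : Block Payload Id} (hb : X.Proposes (P.leader e) e b) (hp : p ∈ honest) {d : Id} {t : ℝ}
    (h : (.vote e d p, t) ∈ (X.state i p).outbox) : d = P.id b := by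
  obtain ⟨j, bc, t', hj⟩ := hb
  obtain ⟨t₂, h₂⟩ := leader_voted A hp hl h
  have h₃ := (localInv A hl j).proposed _ _ _ _ hj
  exact vote_unique A hl (outbox_mono hl (le_max_left i j) h₂)
    (outbox_mono hl (le_max_right i j) h₃)

theorem blockCert_eq [Fintype R] (A : Assumptions P honest) (hl : P.leader e ∈ honest)
    {b : Block Payload Id} (hb : X.Proposes (P.leader e) e b) (hp : p ∈ honest)
    {c : BlockCert R Id} (hc : P.HasBlockCert (X.state i p) c) (he : c.epoch = e) :
    c.id = P.id b := by
  obtain ⟨t, ht⟩ := leader_voted_of_blockCert A hl hp hc he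
  exact vote_eq A hl hb hl ht

theorem exists_proposes [Fintype R] (A : Assumptions P honest) (hl : P.leader e ∈ honest)
    (hG : X.AfterGST e) : ∃ b, X.Proposes (P.leader e) e b := by
  obtain ⟨i, hi⟩ := exists_reached (X := X) A (e + 1) _ hl
  obtain ⟨k, -, -, c, hc, hc', -⟩ := (noSilence A hl hG i).exit_event A hl hl hi
  obtain ⟨t, ht⟩ := leader_voted_of_blockCert A hl hl hc' hc
  obtain ⟨m, -, -, -, b, bc, -, -, hb, -⟩ := leader_proposal A hl ht
  exact ⟨b, m + 1, bc, t, hb⟩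

theorem decision_mono (hp : p ∈ honest) {d : Id} (h : X.Reached p e i)
    (hs : (X.state i p).status e = some .committed) (hd : (X.state i p).decision e = some d)
    (hij : i ≤ j) : (X.state j p).decision e = some d := by
  suffices h : (X.state j p).status e = some .committed ∧ (X.state j p).decision e = some d from h.2
  induction j, hij using Nat.le_induction with
  | base => exact ⟨hs, hd⟩
  | succ j hij ih =>
    have hr := h.mono hp hij
    exact (X.localStep hp j).decision hr.1 hr.2 ih.1 ih.2

/-- In an epoch after GST with an honest leader, every honest replica commits the epoch. -/
theorem exists_committed [Fintype R] (A : Assumptions P honest) (hl : P.leader e ∈ honest)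
    (hG : X.AfterGST e) (hp : p ∈ honest) :
    ∃ j, X.Reached p e j ∧ (X.state j p).status e = some .committed := by
  have hstatus : ∀ j, X.Reached p e j → (X.state j p).status e = some .active ∨
      (X.state j p).status e = some .committed := by
    intro j hj
    have I := localInv (X := X) A hp j
    cases hs : (X.state j p).status e with
    | none => exact absurd ((I.status_none hj.1 e).1 hs) (not_lt.2 hj.2)
    | some σ =>
      cases σ with
      | active => exact .inl rfl
      | committed => exact .inr rfl
      | notCommitted =>
        obtain ⟨c, hc, hc'⟩ := I.notCommitted e hs
        exact absurd hc ((noSilence A hl hG j).not_misbehaviorCert A hl hp hc')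
  obtain ⟨i, hi⟩ := exists_reached (X := X) A (e + 1) p hp
  obtain ⟨k, -, h₁, h₂⟩ := start_event hp hi
  obtain ⟨-, -, -, -, h₃⟩ := (X.localStep hp k).start (localInv A hp k) h₁ h₂.1 h₂.2
  obtain ⟨e', he, h₄, h₅, h₆⟩ := h₃.resolve_left (by simp)
  obtain rfl : e = e' := by omega
  have hk : X.Reached p e k := ⟨h₄, h₅.ge⟩
  rcases hstatus k hk with hs | hs
  swap
  · exact ⟨k, hk, hs⟩
  -- Leaving while `e` is active starts `timeoutCommit`, and `e` stays active until it expires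
  -- unless the fast path decides first. Leaving by the nil timer would need a misbehavior
  -- certificate.
  rcases h₆ with ⟨c, -, -, -, -, h₇⟩ | h₆
  · obtain ⟨m, hm, h₈, h₉⟩ := timer_fires hp (h₇ hs)
    have hr : X.Reached p e m := hk.mono hp ((Nat.le_succ k).trans hm)
    rcases hstatus m hr with hs' | hs'
    swap
    · exact ⟨m, hr, hs'⟩
    · refine ⟨m + 1, hr.mono hp (Nat.le_succ m), ?_⟩
      have h₁₀ := (X.timeout_step m p hp _ h₈).2
      simp only [Protocol.timeoutStep, Protocol.onTimeout, hs', if_true] at h₁₀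
      simp [h₁₀, Protocol.decideEpoch]
  · obtain ⟨m, -, -, -, c, hc, hc', -⟩ := commitNil_event hp h₆
    exact absurd hc ((noSilence A hl hG m).not_misbehaviorCert A hl hp hc')

theorem commitsIn [Fintype R] (A : Assumptions P honest) (hl : P.leader e ∈ honest)
    (hG : X.AfterGST e) {b : Block Payload Id} (hb : X.Proposes (P.leader e) e b)
    (hp : p ∈ honest) : X.CommitsIn p e b := by
  obtain ⟨j, hj, hs⟩ := exists_committed A hl hG hp
  have I := localInv (X := X) A hp j
  obtain ⟨d, hd⟩ := I.committed e hs
  obtain ⟨c, hc, rfl, hc'⟩ := I.decided e d hd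
  rw [blockCert_eq A hl hb hp hc' hc] at hd
  obtain ⟨i, bc, t, hi⟩ := hb
  obtain ⟨T, hT, hr, hdT⟩ := ((eventually_received hl hp hi).and
    ((eventually_of_index (X := X) (Q := X.Reached p e) fun k hk => hj.mono hp hk).and
      (eventually_of_index (X := X)
        (Q := fun k => (X.state k p).decision e = some (P.id b))
        fun k hk => decision_mono hp hj hs hd hk))).exists
  refine ⟨X.endOf T, hdT, ?_⟩
  by_contra hn
  exact not_enabled_endOf hp T 0 ⟨_, .commitBlock e b bc hr.1 hT hdT hn⟩

/-! ### Later blocks extend the block of an epoch after GST with an honest leader -/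

/-- The epoch can only be left by locking on one of its block certificates. Every later lock is from
the then current epoch or more recent than the one it replaces. -/
theorem exists_lock [Fintype R] (A : Assumptions P honest) (hl : P.leader e ∈ honest)
    (hG : X.AfterGST e) (hp : p ∈ honest) :
    ∀ i, X.Reached p (e + 1) i → ∃ c, (X.state i p).lockedBC = some c ∧ e ≤ c.epoch := by
  intro i
  induction i with
  | zero => exact fun h => absurd h (not_reached_zero hp)
  | succ i ih =>
    intro h
    by_cases hi : X.Reached p (e + 1) i
    · obtain ⟨c, hc, hce⟩ := ih hi
      rcases (X.localStep hp i).lock with h' | ⟨c', h', h'' | h''⟩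
      · exact ⟨c, h'.trans hc, hce⟩
      · exact ⟨c', h', by have := hi.2; omega⟩
      · exact ⟨c', h', hce.trans (h'' c hc).le⟩
    · obtain ⟨-, -, -, -, h₃⟩ := (X.localStep hp i).start (localInv A hp i) hi h.1 h.2
      obtain ⟨e', he, -, -, h₆⟩ := h₃.resolve_left (by simp)
      obtain rfl : e = e' := by omega
      rcases h₆ with ⟨c, hc, -, -, hlock, -⟩ | h₆
      · exact ⟨c, hlock, hc.ge⟩
      · obtain ⟨m, -, -, -, c, hc, hcert, -⟩ := commitNil_event hp h₆
        exact absurd hc ((noSilence A hl hG m).not_misbehaviorCert A hl hp hcert)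

/-- The block behind a new vote of an honest replica, and the certificate for its predecessor. -/
theorem vote_event [Fintype R] (A : Assumptions P honest) (hp : p ∈ honest) {d : Id} {t : ℝ}
    (h₀ : (.vote e d p, t) ∉ (X.state i p).outbox)
    (h₁ : (.vote e d p, t) ∈ (X.state (i + 1) p).outbox) :
    X.Reached p e (i + 1) ∧ ∃ (b : Block Payload Id) (bc : Option (BlockCert R Id)), d = P.id b ∧
      b.prev = bc.map BlockCert.id ∧
      ((X.state (i + 1) p).lockedBC = none ∨ ∃ c₀ c, (X.state (i + 1) p).lockedBC = some c₀ ∧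
        bc = some c ∧ c₀.epoch ≤ c.epoch) ∧
      ∀ c ∈ bc, ∃ q ∈ honest, ∃ t, (.vote c.epoch c.id q, t) ∈ (X.state i q).outbox := by
  obtain ⟨-, hs, he, b, bc, hd, hb, -, hc, h⟩ := (X.localStep hp i).vote (localInv A hp i) h₀ h₁
  refine ⟨⟨hs, he.ge⟩, b, bc, hd, hb, hc, fun c hc' => ?_⟩
  rcases h with ⟨-, -, -, h₂, h₃, -⟩ | ⟨-, -, h₂, -⟩
  · exact exists_honest_vote A (h₂.2.2 c hc') (received_authentic hp h₃ c hc')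
  · exact exists_honest_vote A (h₂ c hc').1 (blockCert_signed hp (h₂ c hc'))

/-- The voter's lock forces the certificate in the proposal to be of epoch at least `e`. An honest
signer of that certificate voted earlier: for `b` itself if the epoch is `e`, and by induction for a
descendant of `b` otherwise. -/
theorem later_vote_extends [Fintype R] (A : Assumptions P honest) (hl : P.leader e ∈ honest)
    (hG : X.AfterGST e) {b : Block Payload Id} (hb : X.Proposes (P.leader e) e b) :
    ∀ i, ∀ p ∈ honest, ∀ e' d t, e < e' → (.vote e' d p, t) ∈ (X.state i p).outbox →
      ∃ a, P.id a = d ∧ Relation.TransGen P.Parent b a := by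
  intro i
  induction i with
  | zero => intro p hp; simp [X.state_zero p hp, LocalState.init]
  | succ i ih =>
    intro p hp e' d t he h
    by_cases hold : (.vote e' d p, t) ∈ (X.state i p).outbox
    · exact ih p hp e' d t he hold
    obtain ⟨hr, a, bc, rfl, hprev, hlock, hbc⟩ := vote_event A hp hold h
    obtain ⟨c₁, hc₁, hle⟩ := exists_lock A hl hG hp _ (hr.of_le he)
    obtain ⟨c₀, c, hc₀, rfl, hle'⟩ := hlock.resolve_left (by simp [hc₁])
    obtain rfl : c₁ = c₀ := Option.some.inj (hc₁.symm.trans hc₀)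
    obtain ⟨q, hq, t', ht'⟩ := hbc c rfl
    refine ⟨a, rfl, ?_⟩
    rcases (hle.trans hle').eq_or_lt with h' | h'
    · have hid := vote_eq A hl hb hq (h' ▸ ht')
      exact .single (by rw [Protocol.Parent, hprev, ← hid]; rfl)
    · obtain ⟨a', ha', hext⟩ := ih q hq _ _ _ h' ht'
      exact hext.tail (by rw [Protocol.Parent, hprev, ha']; rfl)

theorem proposes_extends [Fintype R] (A : Assumptions P honest) {e' : ℕ}
    (hl : P.leader e ∈ honest) (hG : X.AfterGST e) (hl' : P.leader e' ∈ honest) (he : e < e')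
    {b b' : Block Payload Id} (hb : X.Proposes (P.leader e) e b)
    (hb' : X.Proposes (P.leader e') e' b') : Relation.TransGen P.Parent b b' := by
  obtain ⟨j, bc, t, hj⟩ := hb'
  obtain ⟨a, ha, h⟩ := later_vote_extends A hl hG hb j _ hl' _ _ _ he
    ((localInv A hl' j).proposed _ _ _ _ hj)
  rwa [← A.id_injective ha]

/-! ### Committed blocks have been voted for -/

/-- The hashes that honest replicas have voted for before event `i`. -/
def votedIds (X : Execution P honest GST) (i : ℕ) : Set Id :=
  {d | ∃ q ∈ honest, ∃ e t, (.vote e d q, t) ∈ (X.state i q).outbox}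

theorem votedIds_finite [Finite R] (X : Execution P honest GST) (i : ℕ) : (X.votedIds i).Finite := by
  have h : (⋃ q ∈ honest, {d | ∃ e t, (.vote e d q, t) ∈ (X.state i q).outbox}).Finite := by
    refine honest.toFinite.biUnion fun q hq => ?_
    -- The hashes of votes are read off the finite outbox; `none` stands for messages that are not
    -- votes.
    refine Set.Finite.of_injOn (f := some)
      (t := (fun x : Msg R Payload Id × ℝ =>
        match x.1 with
        | .vote _ d _ => some d
        | _ => none) '' (X.state i q).outbox) ?_
      (Option.some_injective _).injOn ((outbox_finite hq i).image _)
    rintro d ⟨e, t, h⟩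
    exact ⟨_, h, rfl⟩
  refine h.subset ?_
  rintro d ⟨q, hq, h⟩
  exact Set.mem_biUnion hq h

/-- An honest vote for `b` comes with a certificate for its predecessor, hence with an honest vote
for that. This bounds committed sets, which contain all ancestors of a decided block. -/
theorem votedIds_parent [Fintype R] (A : Assumptions P honest) {a b : Block Payload Id}
    (h : P.id b ∈ X.votedIds i) (hab : P.Parent a b) : P.id a ∈ X.votedIds i := by
  obtain ⟨q, hq, e, t, h⟩ := h
  obtain ⟨k, hk, h₁, h₂, -⟩ := outbox_event hq h
  obtain ⟨-, b', bc, hbb, hprev, -, hbc⟩ := vote_event A hq h₁ h₂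
  obtain rfl := A.id_injective hbb
  rw [Protocol.Parent] at hab
  obtain ⟨c, hc, hca⟩ := Option.map_eq_some_iff.1 (hprev.symm.trans hab)
  obtain ⟨r, hr, t', ht'⟩ := hbc c hc
  exact ⟨r, hr, c.epoch, t', outbox_mono hr hk.le (hca ▸ ht')⟩

theorem votedIds_extends [Fintype R] (A : Assumptions P honest) {a b : Block Payload Id}
    (h : P.id b ∈ X.votedIds i) (hab : P.Extends b a) : P.id a ∈ X.votedIds i := by
  induction hab using Relation.ReflTransGen.head_induction_on with
  | refl => exact h
  | head h' _ ih => exact votedIds_parent A ih h'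

theorem votedIds_mono (hij : i ≤ j) : X.votedIds i ⊆ X.votedIds j := by
  rintro d ⟨q, hq, e, t, h⟩
  exact ⟨q, hq, e, t, outbox_mono hq hij h⟩

theorem committed_voted [Fintype R] (A : Assumptions P honest) (hp : p ∈ honest)
    {b : Block Payload Id} (h : b ∈ (X.state i p).committed) : P.id b ∈ X.votedIds i := by
  induction i with
  | zero => simp [X.state_zero p hp, LocalState.init] at h
  | succ i ih =>
    refine votedIds_mono (Nat.le_succ i) ?_
    rcases (X.localStep hp i).committed h with h | ⟨e, b', hd, hext⟩
    · exact ih h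
    · obtain ⟨c, -, hc, hc'⟩ := (localInv A hp i).decided e _ hd
      obtain ⟨q, hq, t, ht⟩ := exists_honest_vote A hc'.1 (blockCert_signed hp hc')
      exact votedIds_extends A ⟨q, hq, c.epoch, t, hc ▸ ht⟩ hext

/-! ### Liveness -/

/-- At the end of instant `GST` each replica is in some finite epoch, and there are finitely many
replicas. -/
theorem exists_afterGST [Fintype R] (X : Execution P honest GST) :
    ∃ E, ∀ e, E ≤ e → X.AfterGST e := by
  refine ⟨Finset.univ.sup (fun q => (X.state (X.endOf GST) q).epoch) + 1, fun e he q hq i h => ?_⟩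
  by_contra! hlt
  have h₁ : X.Reached q e (i + 1) := ⟨h.2.1, h.2.2.ge⟩
  have h₂ := (h₁.mono hq (lt_endOf.2 hlt.le)).2
  have h₃ := Finset.le_sup (f := fun q => (X.state (X.endOf GST) q).epoch) (Finset.mem_univ q)
  omega

theorem exists_commitsNew [Fintype R] (A : Assumptions P honest)
    (hacyclic : ∀ b, ¬ Relation.TransGen P.Parent b b)
    (hinf : ∀ E, ∃ e, E ≤ e ∧ P.leader e ∈ honest) (hp : p ∈ honest) (T : ℝ) :
    ∃ i b, T ≤ X.time i ∧ X.CommitsNew p b i := by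
  obtain ⟨E, hE⟩ := X.exists_afterGST
  let S : Set ℕ := {e | E ≤ e ∧ P.leader e ∈ honest}
  have hS : S.Infinite := by
    rw [Set.infinite_iff_exists_gt]
    intro n
    obtain ⟨e, he, hl⟩ := hinf (max E (n + 1))
    exact ⟨e, ⟨(le_max_left _ _).trans he, hl⟩, (le_max_right _ _).trans he⟩
  have hex : ∀ e : S, ∃ b, X.Proposes (P.leader e) e b := fun e =>
    exists_proposes A e.2.2 (hE e e.2.1)
  choose β hβ using hex
  have hlt : ∀ e e' : S, (e : ℕ) < e' → P.id (β e) ≠ P.id (β e') := fun e e' h h' => by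
    have hext := proposes_extends A e.2.2 (hE e e.2.1) e'.2.2 h (hβ e) (hβ e')
    rw [A.id_injective h'] at hext
    exact hacyclic _ hext
  have hinj : Function.Injective fun e => P.id (β e) := by
    intro e e' h
    by_contra hne
    rcases lt_or_gt_of_ne (fun h => hne (Subtype.ext h) : (e : ℕ) ≠ e') with h' | h'
    · exact hlt e e' h' h
    · exact hlt e' e h' h.symm
  have := hS.to_subtype
  -- Infinitely many proposed hashes against finitely many voted ones: some leader's block has no
  -- honest vote by time `T`, so it is not yet committed.
  obtain ⟨_, ⟨e, rfl⟩, he⟩ :=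
    (Set.infinite_range_of_injective hinj).exists_notMem_finite (X.votedIds_finite (X.endOf T))
  obtain ⟨i, -, hi⟩ := commitsIn A e.2.2 (hE e e.2.1) (hβ e) hp
  have hn : β e ∉ (X.state (X.endOf T) p).committed := fun h => he (committed_voted A hp h)
  obtain ⟨k, -, hk₁, hk₂⟩ := exists_step (Q := fun k => β e ∈ (X.state k p).committed)
    (fun h => hn (committed_mono hp (Nat.zero_le _) h)) hi
  refine ⟨k, β e, ?_, hk₁, hk₂⟩
  have hk : X.endOf T ≤ k := by
    by_contra! hlt
    exact hn (committed_mono hp (Nat.succ_le_of_lt hlt) hk₂)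
  exact (X.lt_time_endOf T).le.trans (X.time_mono hk)

end Execution

end AlterBFT

theorem mainTheorem2 {R Payload Id : Type*} [Fintype R]
    (P : AlterBFT.Protocol R Payload Id) (honest : Set R) (GST : ℝ)
    (hn : 2 * P.f < Fintype.card R)
    (hfaulty : honestᶜ.ncard ≤ P.f)
    (hΔS : 0 < P.ΔS) (hΔL : P.ΔS ≤ P.ΔL)
    (hid : Function.Injective P.id)
    (hacyclic : ∀ b, ¬ Relation.TransGen P.Parent b b)
    (hpayload : ∀ p ∈ honest, ∀ e prev, (∀ h ∈ prev, ∃ a, P.valid a ∧ P.id a = h) →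
      P.valid ⟨P.getPayload p e prev, prev⟩)
    (X : AlterBFT.Execution P honest GST) :
    (∀ e, P.leader e ∈ honest → X.AfterGST e →
      (∃ b, X.Proposes (P.leader e) e b) ∧
      ∀ b, X.Proposes (P.leader e) e b → ∀ p ∈ honest, X.CommitsIn p e b) ∧
    ((∀ E, ∃ e, E ≤ e ∧ P.leader e ∈ honest) →
      ∀ p ∈ honest, ∀ T : ℝ, ∃ i b, T ≤ X.time i ∧ X.CommitsNew p b i) := by
  have A : AlterBFT.Assumptions P honest := ⟨hn, hfaulty, hΔS, hΔL, hid, hpayload⟩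
  exact ⟨fun e hl hG => ⟨AlterBFT.Execution.exists_proposes A hl hG, fun b hb p hp =>
    AlterBFT.Execution.commitsIn A hl hG hb hp⟩, fun hinf p hp T =>
    AlterBFT.Execution.exists_commitsNew A hacyclic hinf hp T⟩
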